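/- Let $p>2$ be a prime, $F$ a finite extension of $\mathbb{Q}_p$, $E/F$ an unramified quadratic extension with nontrivial automorphism $x\mapsto\bar x$, $\varpi$ a uniformizer of $F$, $v$ the valuation of $E$ with $v(\varpi)=1$ and $v(0)=\infty$, $q$ the cardinality of the residue field of $F$, and $|x|_F=q^{-v(x)}$, $\eta(x)=(-1)^{v(x)}$ for $x\in F^\times$. Let $S_2(F)=\{g\in \mathrm{GL}_2(E): g\bar g=1\}$. For an integer $r\ge 0$ let $K'_{S,\le r}$ be the set of $g\in S_2(F)$ all of whose entries lie in $\varpi^{-r}\mathcal{O}_E$. For $\gamma\in S_2(F)$, a column vector $\mathbf u\in F^2$, a row vector $\mathbf v^\top\in (F^2)^\vee$ and $s\in\mathbb{C}$ put $$\mathrm{Orb}((\gamma,\mathbf u,\mathbf v^\top),\mathbf 1_{K'_{S,\le r}},s)=\int_{\mathrm{GL}_2(F)}\mathbf 1_{K'_{S,\le r}}(h\gamma h^{-1})\,\mathbf 1_{\mathcal{O}_F^2\times(\mathcal{O}_F^2)^\vee}(h\mathbf u,\mathbf v^\top h^{-1})\,\eta(\det h)\,|\det h|_F^{-s}\,dh,$$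 where $dh$ is the Haar measure giving $\mathrm{GL}_2(\mathcal{O}_F)$ volume $1$, and let $\partial\mathrm{Orb}$ denote its derivative with respect to $s$ at $s=0$. Let $\mathbb V_2^-$ be the non-split $E/F$-Hermitian space of dimension $2$, realized as $E^2$ with the form $\langle x,y\rangle=x_0\bar y_0-\varpi x_1\bar y_1$. Write $(S_2(F)\times V_2'(F))_{\mathrm{rs}}^-$ for the set of triples $(\gamma,\mathbf u,\mathbf v^\top)$ as above which are regular semisimple (that is, $\mathbf u,\gamma\mathbf u$ and $\mathbf v^\top,\mathbf v^\top\gamma$ are bases of $E^2$) and match a regular semisimple pair $(g,w)\in \mathrm U(\mathbb V_2^-)\times\mathbb V_2^-$, meaning that for some $P\in \mathrm{GL}_2(E)$ one has $P\gamma P^{-1}=g$, $P\mathbf u=w$ and $\mathbf v^\top P^{-1}=\langle\,\cdot\,,w\rangle$. Let $a,b,c,d\in E$ and $e\in F$ be such that $$(\gamma,\mathbf u,\mathbf v^\top)=\left(\begin{pmatrix}a&b\\c&d\end{pmatrix},\begin{pmatrix}0\\1\end{pmatrix},\begin{pmatrix}0&e\end{pmatrix}\right)\in(S_2(F)\times V_2'(F))_{\mathrm{rs}}^-.$$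 (Then $bce\ne0$ and $v(b)+v(c)$ is odd and positive.) Let $r\ge0$ be an integer and $$N=\min\left(v(e),\ \tfrac{v(b)+v(c)-1}{2}+r,\ v(d-a)+r\right),\qquad \varkappa=v(e)-(v(d-a)+r).$$ Then the integral defining $\mathrm{Orb}((\gamma,\mathbf u,\mathbf v^\top),\mathbf 1_{K'_{S,\le r}},s)$ converges absolutely for every $s\in\mathbb{C}$, it is differentiable in $s$ at $s=0$, and the following holds, where a sum over $0\le j\le N$ is $0$ if $N<0$. If $\varkappa\ge0$ and $v(b)+v(c)>2v(d-a)$ (in particular $d\neq a$), then $$\frac{(-1)^{v(c)+r}}{\log q}\,\partial\mathrm{Orb}((\gamma,\mathbf u,\mathbf v^\top),\mathbf 1_{K'_{S,\le r}})=\sum_{j=0}^N\left(\tfrac{2v(e)+v(b)+v(c)+1}{2}+r-2j\right)q^j-q^{v(d-a)+r}\,C,$$ where $C=\frac{\varkappa}{2}$ if $\varkappa$ is even, and $C=\left(v(e)+\frac{v(b)+v(c)}{2}-2v(d-a)-r\right)-\frac{\varkappa}{2}$ if $\varkappa$ is odd. Otherwise $$\frac{(-1)^{v(c)+r}}{\log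 q}\,\partial\mathrm{Orb}((\gamma,\mathbf u,\mathbf v^\top),\mathbf 1_{K'_{S,\le r}})=\sum_{j=0}^N\left(\tfrac{2v(e)+v(b)+v(c)+1}{2}+r-2j\right)q^j.$$ -/

import Mathlib

open MeasureTheory
open scoped MatrixGroups Matrix

/- Conventions.  `F` is a finite extension of `ℚ_[p]` carrying its norm extending the `p`-adic norm,
`E` is a finite extension of `F` carrying its norm extending that of `F`.  These norms are unique, so
they carry no extra data; the ring of integers is the closed unit ball.  Vectors and covectors
(row vectors) of length `n` are functions on `Fin n`. -/

/-- A uniformizer of a (discretely valued) nonarchimedean field: a nonzero generator of the maximal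
ideal `{x | ‖x‖ < 1}` of the unit ball. -/
def IsUniformizer {K : Type*} [NormedField K] (ϖ : K) : Prop :=
  ϖ ≠ 0 ∧ ‖ϖ‖ < 1 ∧ ∀ x : K, ‖x‖ < 1 → ‖x‖ ≤ ‖ϖ‖

/-- `E/F` is an unramified quadratic extension: it has degree two, and the maximal ideal of the ring
of integers of `F` generates that of `E`.  (The residue fields of local fields are finite, hence the
residue field extension is automatically separable.) -/
structure IsUnramifiedQuadratic (F E : Type*) [NormedField F] [NormedField E]
    [NormedAlgebra F E] : Prop where
  finrank_eq_two : Module.finrank F E = 2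
  isUniformizer_map : ∀ ϖ : F, IsUniformizer ϖ → IsUniformizer (algebraMap F E ϖ)

theorem isUltrametricDist_of_padic (p : ℕ) [Fact p.Prime] (K : Type*) [NormedField K]
    [NormedAlgebra ℚ_[p] K] : IsUltrametricDist K :=
  IsUltrametricDist.of_normedAlgebra ℚ_[p]

/-- The ring of integers of a finite extension of `ℚ_[p]`. -/
noncomputable def integerRing (p : ℕ) [Fact p.Prime] (F : Type*) [NormedField F]
    [NormedAlgebra ℚ_[p] F] : ValuationSubring F :=
  haveI := isUltrametricDist_of_padic p F
  (NormedField.valuation (K := F)).valuationSubring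

theorem mem_integerRing_iff (p : ℕ) [Fact p.Prime] (F : Type*) [NormedField F]
    [NormedAlgebra ℚ_[p] F] (x : F) : x ∈ integerRing p F ↔ ‖x‖ ≤ 1 := by
  have := isUltrametricDist_of_padic p F
  exact Iff.rfl

/-- `q`, the cardinality of the residue field of `F`. -/
noncomputable def residueCard (p : ℕ) [Fact p.Prime] (F : Type*) [NormedField F]
    [NormedAlgebra ℚ_[p] F] : ℕ :=
  Nat.card (IsLocalRing.ResidueField (integerRing p F))

/-- The normalized valuation `v` with `v(ϖ) = 1`: for `x ≠ 0`, the integer `n` such that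
`‖x‖ = ‖ϖ‖ ^ n`, see `val_eq`.  The value at `0` is junk; see `valTop`. -/
noncomputable def val {F K : Type*} [NormedField F] [NormedField K] (ϖ : F) (x : K) : ℤ :=
  ⌊Real.logb ‖ϖ‖ ‖x‖⌋

theorem val_eq {F K : Type*} [NormedField F] [NormedField K] {ϖ : F} (hϖ : IsUniformizer ϖ)
    {x : K} {n : ℤ} (hx : ‖x‖ = ‖ϖ‖ ^ n) : val ϖ x = n := by
  have h0 : 0 < ‖ϖ‖ := norm_pos_iff.mpr hϖ.1
  have h1 : Real.log ‖ϖ‖ ≠ 0 := (Real.log_neg h0 hϖ.2.1).ne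
  rw [val, hx, Real.logb, Real.log_zpow, mul_div_assoc, div_self h1, mul_one, Int.floor_intCast]

open Classical in
/-- The valuation `v`, with `v(0) = ∞`. -/
noncomputable def valTop {F K : Type*} [NormedField F] [NormedField K] (ϖ : F) (x : K) :
    WithTop ℤ :=
  if x = 0 then ⊤ else (val ϖ x : WithTop ℤ)

/-- The symmetric space `S_n(F) = {g ∈ GL_n(E) | g * conj g = 1}`, as a set of matrices
(the equation forces invertibility). -/
def symmSpace {F E : Type*} [Field F] [Field E] [Algebra F E] (σ : E ≃ₐ[F] E) (n : ℕ) :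
    Set (Matrix (Fin n) (Fin n) E) :=
  {g | g * g.map σ = 1}

/-- `K'_{S,≤r}`: the elements of `S_n(F)` all of whose entries lie in `ϖ^{-r} O_E`. -/
def symmSpaceLE {F E : Type*} [NormedField F] [NormedField E] [NormedAlgebra F E]
    (σ : E ≃ₐ[F] E) (ϖ : F) (n r : ℕ) : Set (Matrix (Fin n) (Fin n) E) :=
  {g | g ∈ symmSpace σ n ∧ ∀ i j, ‖algebraMap F E ϖ ^ r * g i j‖ ≤ 1}

/-- Regular semisimplicity of `(γ, u, vᵀ)`: the vectors `u, γu, …, γ^(n-1)u` and the covectors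
`vᵀ, vᵀγ, …, vᵀγ^(n-1)` are bases of `E^n`. -/
def IsRegularSemisimple {E : Type*} [Field E] {n : ℕ} (γ : Matrix (Fin n) (Fin n) E)
    (u v : Fin n → E) : Prop :=
  LinearIndependent E (fun i : Fin n => (γ ^ (i : ℕ)) *ᵥ u) ∧
  LinearIndependent E (fun i : Fin n => v ᵥ* (γ ^ (i : ℕ)))

/-- Gram matrix of the non-split Hermitian plane `V_2^-`, realized on the quaternion division algebra
`E ⊕ E Π`, `Π² = ϖ`, with `⟨x₀ + x₁Π, y₀ + y₁Π⟩ = x₀ conj(y₀) - ϖ x₁ conj(y₁)`. -/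
def nonsplitGram {F : Type*} (E : Type*) [Field F] [Field E] [Algebra F E] (ϖ : F) :
    Matrix (Fin 2) (Fin 2) E :=
  !![1, 0; 0, -algebraMap F E ϖ]

/-- The unitary group `U(V_2^-)`, as a set of matrices. -/
def unitarySet {F E : Type*} [Field F] [Field E] [Algebra F E] (σ : E ≃ₐ[F] E) (ϖ : F) :
    Set (Matrix (Fin 2) (Fin 2) E) :=
  {g | (g.map σ)ᵀ * nonsplitGram E ϖ * g = nonsplitGram E ϖ}

/-- The covector `w^* = ⟨·, w⟩` attached to `w ∈ V_2^-`. -/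
def adjointCovector {F E : Type*} [Field F] [Field E] [Algebra F E] (σ : E ≃ₐ[F] E) (ϖ : F)
    (w : Fin 2 → E) : Fin 2 → E :=
  (fun i => σ (w i)) ᵥ* nonsplitGram E ϖ

/-- `(γ, u, vᵀ)` matches `(g, w)`: the matrices `[γ, u; vᵀ, 0]` and `[g, w; w^*, 0]` are conjugate by
an element of `GL_2(E)` (embedded block-diagonally in `GL_3(E)`). -/
def Matches {F E : Type*} [Field F] [Field E] [Algebra F E] (σ : E ≃ₐ[F] E) (ϖ : F)
    (γ : Matrix (Fin 2) (Fin 2) E) (u v : Fin 2 → E)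
    (g : Matrix (Fin 2) (Fin 2) E) (w : Fin 2 → E) : Prop :=
  ∃ P : GL (Fin 2) E,
    (P : Matrix (Fin 2) (Fin 2) E) * γ * ((P⁻¹ : GL (Fin 2) E) : Matrix (Fin 2) (Fin 2) E) = g ∧
    (P : Matrix (Fin 2) (Fin 2) E) *ᵥ u = w ∧
    v ᵥ* ((P⁻¹ : GL (Fin 2) E) : Matrix (Fin 2) (Fin 2) E) = adjointCovector σ ϖ w

/-- `(S_2(F) × V'_2(F))_rs^-`: the regular semisimple triples in `S_2(F) × F² × (F²)^∨` which match a
regular semisimple element of `U(V_2^-) × V_2^-`. -/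
def rsMinus {F E : Type*} [Field F] [Field E] [Algebra F E] (σ : E ≃ₐ[F] E) (ϖ : F) :
    Set (Matrix (Fin 2) (Fin 2) E × (Fin 2 → F) × (Fin 2 → F)) :=
  {x | x.1 ∈ symmSpace σ 2 ∧
    IsRegularSemisimple x.1 (fun i => algebraMap F E (x.2.1 i))
      (fun i => algebraMap F E (x.2.2 i)) ∧
    ∃ g ∈ unitarySet σ ϖ, ∃ w : Fin 2 → E,
      IsRegularSemisimple g w (adjointCovector σ ϖ w) ∧
      Matches σ ϖ x.1 (fun i => algebraMap F E (x.2.1 i))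
        (fun i => algebraMap F E (x.2.2 i)) g w}

/-- `GL_n(O_F)` as a subset of `GL_n(F)`. -/
def integralGL (F : Type*) [NormedField F] (n : ℕ) : Set (GL (Fin n) F) :=
  {h | ∀ i j, ‖(h : Matrix (Fin n) (Fin n) F) i j‖ ≤ 1 ∧
    ‖((h⁻¹ : GL (Fin n) F) : Matrix (Fin n) (Fin n) F) i j‖ ≤ 1}

/-- The quadratic character `η(x) = (-1)^{v(x)}` of `F^×` attached to the unramified quadratic
extension. -/
noncomputable def quadChar {F : Type*} [NormedField F] (ϖ x : F) : ℂ := (-1) ^ val ϖ x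

/-- The normalized absolute value `|x|_F = q^{-v(x)}` of `x ∈ F^×`. -/
noncomputable def normalizedAbs (p : ℕ) [Fact p.Prime] {F : Type*} [NormedField F]
    [NormedAlgebra ℚ_[p] F] (ϖ x : F) : ℝ := (residueCard p F : ℝ) ^ (-val ϖ x)

/-- The indicator function of `O_F^n × (O_F^n)^∨`. -/
noncomputable def integralIndicator {F : Type*} [NormedField F] {n : ℕ} :
    (Fin n → F) × (Fin n → F) → ℂ :=
  Set.indicator {x | ∀ i, ‖x.1 i‖ ≤ 1 ∧ ‖x.2 i‖ ≤ 1} 1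

/-- The integrand of the weighted orbital integral,
`φ(hγh⁻¹) 1_{O_F^n × (O_F^n)^∨}(hu, vᵀh⁻¹) η(det h) |det h|_F^{-s}`. -/
noncomputable def orbIntegrand (p : ℕ) [Fact p.Prime] {F E : Type*} [NormedField F]
    [NormedAlgebra ℚ_[p] F] [NormedField E] [NormedAlgebra F E] (ϖ : F) {n : ℕ}
    (φ : Matrix (Fin n) (Fin n) E → ℂ)
    (x : Matrix (Fin n) (Fin n) E × (Fin n → F) × (Fin n → F)) (s : ℂ) (h : GL (Fin n) F) : ℂ :=
  φ ((h : Matrix (Fin n) (Fin n) F).map (algebraMap F E) * x.1 *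
      ((h⁻¹ : GL (Fin n) F) : Matrix (Fin n) (Fin n) F).map (algebraMap F E)) *
    integralIndicator ((h : Matrix (Fin n) (Fin n) F) *ᵥ x.2.1,
      x.2.2 ᵥ* ((h⁻¹ : GL (Fin n) F) : Matrix (Fin n) (Fin n) F)) *
    quadChar ϖ (h : Matrix (Fin n) (Fin n) F).det *
    (normalizedAbs p ϖ (h : Matrix (Fin n) (Fin n) F).det : ℂ) ^ (-s)

/-- The weighted orbital integral `Orb((γ, u, vᵀ), φ ⊗ 1_{O_F^n × (O_F^n)^∨}, s)`. -/
noncomputable def Orb (p : ℕ) [Fact p.Prime] {F E : Type*} [NormedField F]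
    [NormedAlgebra ℚ_[p] F] [NormedField E] [NormedAlgebra F E] (ϖ : F) {n : ℕ}
    [MeasurableSpace (GL (Fin n) F)] (μ : Measure (GL (Fin n) F))
    (φ : Matrix (Fin n) (Fin n) E → ℂ)
    (x : Matrix (Fin n) (Fin n) E × (Fin n → F) × (Fin n → F)) (s : ℂ) : ℂ :=
  ∫ h, orbIntegrand p ϖ φ x s h ∂μ

/-- The derivative `∂Orb((γ, u, vᵀ), φ)` of the weighted orbital integral at `s = 0`. -/
noncomputable def dOrb (p : ℕ) [Fact p.Prime] {F E : Type*} [NormedField F]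
    [NormedAlgebra ℚ_[p] F] [NormedField E] [NormedAlgebra F E] (ϖ : F) {n : ℕ}
    [MeasurableSpace (GL (Fin n) F)] (μ : Measure (GL (Fin n) F))
    (φ : Matrix (Fin n) (Fin n) E → ℂ)
    (x : Matrix (Fin n) (Fin n) E × (Fin n → F) × (Fin n → F)) : ℂ :=
  deriv (fun s : ℂ => Orb p ϖ μ φ x s) 0

/-- `N = min (v(e), (v(b) + v(c) - 1) / 2 + r, v(d - a) + r)`, where `v(d - a)` may be `∞`. -/
def cutoff (ve vb vc : ℤ) (vda : WithTop ℤ) (r : ℕ) : ℤ :=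
  (min ((min ve ((vb + vc - 1) / 2 + r) : ℤ) : WithTop ℤ) (vda + ((r : ℤ) : WithTop ℤ))).untopD 0

/-- `∑_{j=0}^N ((2v(e) + v(b) + v(c) + 1)/2 + r - 2j) q^j` (an empty sum if `N < 0`). -/
noncomputable def mainSum (q : ℕ) (ve vb vc : ℤ) (r : ℕ) (N : ℤ) : ℂ :=
  ∑ j ∈ Finset.Icc (0 : ℤ) N,
    ((2 * (ve : ℂ) + vb + vc + 1) / 2 + r - 2 * j) * (q : ℂ) ^ j

/-- The correction factor multiplying `q^{v(d-a)+r}`, with `ϰ = v(e) - (v(d-a) + r)`. -/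
noncomputable def correction (ve vb vc vda : ℤ) (r : ℕ) : ℂ :=
  if Even (ve - (vda + r)) then ((ve - (vda + r) : ℤ) : ℂ) / 2
  else ((ve : ℂ) + (vb + vc) / 2 - 2 * vda - r) - ((ve - (vda + r) : ℤ) : ℂ) / 2

/-! The integrand is left invariant under `GL_2(O_F)`, so by the Iwasawa decomposition the integral
is a sum over representatives with rows `(ϖ^m, y)` and `(0, ϖ^n)`, where `y` matters only modulo
`ϖ^n O_F`. The modular character is trivial on these elements, so every coset has volume one
(`integral_GL_two_eq_sum`).

The relation `γ γ̄ = 1` forces `A = (d-a)/c` and `B = b/c` to lie in `F`. Matching with the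
non-split plane makes the Gram determinant `e²(1 - d d̄)` equal to `-ϖ` times a norm. Norms from the
unramified extension have even valuation, so `1 - d d̄ = c b̄` has odd valuation
(`rsMinus_structure`).

Put `l = m - r - v(c)` and `i = n - l`. The support conditions become `0 ≤ n ≤ v(e)`, `i ≥ 0`, `v(y)
≥ max(0, l)` and `v(B' + A'y - y²) ≥ l + n`, where `A' = Aϖ^m` and `B' = Bϖ^{2m}`
(`orbSupport_upperGL_iff`). Since `v(B)` is odd, `v(B) = 2v(A)` cannot occur. If `2v(A) > v(B)`, the
linear term is negligible and the solutions form one ball about `0` or the empty set. If `2v(A) <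
v(B)`, the polynomial has two roots of distinct valuations in `F`, and for large `i` the ball breaks
up into one ball around each root. This gives the counts `nonsplitCount` and `splitCount`.

The determinant has valuation `2n - i + r + v(c)`. Up to the normalizing factor, the derivative is
therefore the sum of `(-1)^i (2n - i + r + v(c))` times the number of classes. Consecutive `i = 2j,
2j+1` with equal counts telescope to `q^{min(n,j)}`, and summing over `n` gives the main sum. The
correction comes from `n ≥ v(d-a) + r`, where the two root balls cease to contribute at indices `i`
of opposite parity (`sum_splitCount`). -/

/-! ### Norms as integral powers of the norm of a uniformizer -/

theorem IsUniformizer.norm_pos {K : Type*} [NormedField K] {ϖ : K} (h : IsUniformizer ϖ) :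
    0 < ‖ϖ‖ :=
  norm_pos_iff.mpr h.1

theorem IsUniformizer.zpow_le_zpow_iff {K : Type*} [NormedField K] {ϖ : K} (h : IsUniformizer ϖ)
    {m n : ℤ} : ‖ϖ‖ ^ m ≤ ‖ϖ‖ ^ n ↔ n ≤ m :=
  zpow_le_zpow_iff_right_of_lt_one₀ h.norm_pos h.2.1

theorem IsUniformizer.zpow_lt_zpow_iff {K : Type*} [NormedField K] {ϖ : K} (h : IsUniformizer ϖ)
    {m n : ℤ} : ‖ϖ‖ ^ m < ‖ϖ‖ ^ n ↔ n < m :=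
  zpow_lt_zpow_iff_right_of_lt_one₀ h.norm_pos h.2.1

theorem IsUniformizer.zpow_pos {K : Type*} [NormedField K] {ϖ : K} (h : IsUniformizer ϖ)
    (n : ℤ) : 0 < ‖ϖ‖ ^ n :=
  _root_.zpow_pos h.norm_pos n

theorem IsUniformizer.zpow_inj {K : Type*} [NormedField K] {ϖ : K} (h : IsUniformizer ϖ)
    {m n : ℤ} (hmn : ‖ϖ‖ ^ m = ‖ϖ‖ ^ n) : m = n :=
  le_antisymm (h.zpow_le_zpow_iff.mp hmn.ge) (h.zpow_le_zpow_iff.mp hmn.le)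

theorem IsUniformizer.exists_norm_eq_zpow {K : Type*} [NormedField K] {ϖ : K}
    (h : IsUniformizer ϖ) {x : K} (hx : x ≠ 0) : ∃ n : ℤ, ‖x‖ = ‖ϖ‖ ^ n := by
  have h0 := h.norm_pos
  obtain ⟨n, hn1, hn2⟩ := exists_mem_Ioc_zpow (norm_pos_iff.mpr hx)
    (one_lt_inv₀ h0 |>.mpr h.2.1)
  refine ⟨-(n + 1), ?_⟩
  rw [inv_zpow', neg_add] at hn2
  rw [inv_zpow'] at hn1
  have hz : 0 < ‖ϖ‖ ^ (-(n + 1)) := h.zpow_pos _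
  -- If the norm were not an exact power, rescaling `x` by a power of `ϖ` would give a norm strictly
  -- between `‖ϖ‖` and `1`, against the maximality of `‖ϖ‖`.
  have key := h.2.2 (x * ϖ ^ (n + 1))
  rw [norm_mul, norm_zpow] at key
  rw [neg_add]
  refine le_antisymm hn2 ?_
  by_contra! hlt
  have e1 : ‖ϖ‖ ^ (-n + -1) * ‖ϖ‖ ^ (n + 1) = 1 := by
    rw [← zpow_add₀ h0.ne', show -n + -1 + (n + 1) = 0 by ring, zpow_zero]
  have e2 : ‖ϖ‖ ^ (-n) * ‖ϖ‖ ^ (n + 1) = ‖ϖ‖ := by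
    rw [← zpow_add₀ h0.ne', show -n + (n + 1) = 1 by ring, zpow_one]
  have := key (by rw [← e1]; exact mul_lt_mul_of_pos_right hlt (h.zpow_pos _))
  exact absurd (le_of_mul_le_mul_right (this.trans_eq e2.symm) (h.zpow_pos _)) (not_le.mpr hn1)

theorem norm_eq_zpow_val {F K : Type*} [NormedField F] [NormedField K] [NormedAlgebra F K] {ϖ : F}
    (hϖ : IsUniformizer ϖ) (hK : IsUniformizer (algebraMap F K ϖ)) {x : K} (hx : x ≠ 0) :
    ‖x‖ = ‖ϖ‖ ^ val ϖ x := by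
  obtain ⟨n, hn⟩ := hK.exists_norm_eq_zpow hx
  rw [norm_algebraMap'] at hn
  rw [hn, val_eq hϖ hn]

theorem IsUniformizer.norm_eq_zpow_val {F : Type*} [NormedField F] {ϖ : F}
    (hϖ : IsUniformizer ϖ) {x : F} (hx : x ≠ 0) : ‖x‖ = ‖ϖ‖ ^ val ϖ x := by
  obtain ⟨n, hn⟩ := hϖ.exists_norm_eq_zpow hx
  rw [hn, val_eq hϖ hn]

/-! ### Residue systems and classes modulo powers of the uniformizer -/

theorem exists_residue_transversal (p : ℕ) [Fact p.Prime] (F : Type*) [NormedField F]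
    [NormedAlgebra ℚ_[p] F] [FiniteDimensional ℚ_[p] F] {ϖ : F} (hϖ : IsUniformizer ϖ) :
    1 < residueCard p F ∧ ∃ R : Finset F, R.card = residueCard p F ∧ (∀ x ∈ R, ‖x‖ ≤ 1) ∧
      (∀ x ∈ R, ∀ y ∈ R, ‖x - y‖ ≤ ‖ϖ‖ → x = y) ∧
      ∀ x : F, ‖x‖ ≤ 1 → ∃ y ∈ R, ‖x - y‖ ≤ ‖ϖ‖ := by
  have hu := isUltrametricDist_of_padic p F
  have : ProperSpace F := FiniteDimensional.proper ℚ_[p] F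
  have hmax : ∀ x : integerRing p F,
      x ∈ IsLocalRing.maximalIdeal (integerRing p F) ↔ ‖(x : F)‖ < 1 := by
    intro x
    exact (Valuation.mem_maximalIdeal_iff (v := NormedField.valuation (K := F))
      (a := x))
  have hres : ∀ x y : integerRing p F, IsLocalRing.residue _ x = IsLocalRing.residue _ y ↔
      ‖(x : F) - y‖ ≤ ‖ϖ‖ := by
    intro x y
    rw [← sub_eq_zero, ← map_sub, IsLocalRing.residue_eq_zero_iff, hmax]
    exact ⟨fun h => hϖ.2.2 _ h, fun h => h.trans_lt hϖ.2.1⟩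
  -- Compactness of the unit ball: finitely many balls of radius `‖ϖ‖` cover it, and each lies in
  -- one residue class.
  have hfin : Finite (IsLocalRing.ResidueField (integerRing p F)) := by
    obtain ⟨t, hts, htf, htc⟩ := (isCompact_closedBall (0 : F) 1).finite_cover_balls hϖ.norm_pos
    have := htf.to_subtype
    refine Finite.of_surjective (fun x : t => IsLocalRing.residue (integerRing p F)
      ⟨x, (mem_integerRing_iff p F _).mpr (by simpa using hts x.2)⟩) fun z => ?_
    obtain ⟨y, rfl⟩ := IsLocalRing.residue_surjective z
    have hy : (y : F) ∈ Metric.closedBall (0 : F) 1 := by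
      simpa using (mem_integerRing_iff p F _).mp y.2
    obtain ⟨x, hx, hxy⟩ := Set.mem_iUnion₂.mp (htc hy)
    refine ⟨⟨x, hx⟩, (hres _ _).mpr ?_⟩
    rw [norm_sub_rev, ← dist_eq_norm]
    exact (Metric.mem_ball.mp hxy).le
  refine ⟨Finite.one_lt_card, ?_⟩
  classical
  have := Fintype.ofFinite (IsLocalRing.ResidueField (integerRing p F))
  let g : IsLocalRing.ResidueField (integerRing p F) → integerRing p F :=
    Function.surjInv IsLocalRing.residue_surjective
  have hg : ∀ z, IsLocalRing.residue _ (g z) = z := Function.surjInv_eq _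
  refine ⟨Finset.univ.image fun z => (g z : F), ?_, ?_, ?_, ?_⟩
  · rw [Finset.card_image_of_injective Finset.univ (f := fun z => (g z : F))
      (Subtype.val_injective.comp (Function.injective_surjInv _)), residueCard, Nat.card_eq_fintype_card, Finset.card_univ]
  · simp only [Finset.mem_image, Finset.mem_univ, true_and]
    rintro _ ⟨z, rfl⟩
    exact (mem_integerRing_iff p F _).mp (g z).2
  · simp only [Finset.mem_image, Finset.mem_univ, true_and]
    rintro _ ⟨z, rfl⟩ _ ⟨w, rfl⟩ h
    rw [← hres, hg, hg] at h
    rw [h]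
  · intro x hx
    refine ⟨g (IsLocalRing.residue _ ⟨x, (mem_integerRing_iff p F _).mpr hx⟩),
      Finset.mem_image_of_mem _ (Finset.mem_univ _), ?_⟩
    exact (hres ⟨x, (mem_integerRing_iff p F _).mpr hx⟩ _).mp (hg _).symm

/-- `Y` is a system of representatives of `S` modulo `ϖ ^ n O_F`. -/
structure IsTransversal {F : Type*} [NormedField F] (ϖ : F) (n : ℤ) (S : Set F) (Y : Finset F) :
    Prop where
  subset : ∀ y ∈ Y, y ∈ S
  eq_of_norm_le : ∀ x ∈ Y, ∀ y ∈ Y, ‖x - y‖ ≤ ‖ϖ‖ ^ n → x = y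
  exists_norm_le : ∀ x ∈ S, ∃ y ∈ Y, ‖x - y‖ ≤ ‖ϖ‖ ^ n

theorem isTransversal_empty {F : Type*} [NormedField F] (ϖ : F) (n : ℤ) :
    IsTransversal ϖ n (∅ : Set F) ∅ :=
  ⟨by simp, by simp, by simp⟩

theorem exists_isTransversal_union {F : Type*} [NormedField F] {ϖ : F} {n : ℤ} {S₁ S₂ : Set F}
    (hS : ∀ x ∈ S₁, ∀ y ∈ S₂, ‖ϖ‖ ^ n < ‖x - y‖) {k₁ k₂ : ℕ}
    (h₁ : ∃ Y, IsTransversal ϖ n S₁ Y ∧ Y.card = k₁)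
    (h₂ : ∃ Y, IsTransversal ϖ n S₂ Y ∧ Y.card = k₂) :
    ∃ Y, IsTransversal ϖ n (S₁ ∪ S₂) Y ∧ Y.card = k₁ + k₂ := by
  classical
  obtain ⟨Y₁, h₁, rfl⟩ := h₁
  obtain ⟨Y₂, h₂, rfl⟩ := h₂
  refine ⟨Y₁ ∪ Y₂, ⟨?_, ?_, ?_⟩, Finset.card_union_of_disjoint ?_⟩
  · intro y hy
    exact (Finset.mem_union.mp hy).imp (h₁.subset y) (h₂.subset y)
  · intro x hx y hy h
    rcases Finset.mem_union.mp hx with hx | hx <;> rcases Finset.mem_union.mp hy with hy | hy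
    · exact h₁.eq_of_norm_le x hx y hy h
    · exact absurd h (hS x (h₁.subset x hx) y (h₂.subset y hy)).not_ge
    · rw [norm_sub_rev] at h
      exact absurd h (hS y (h₁.subset y hy) x (h₂.subset x hx)).not_ge
    · exact h₂.eq_of_norm_le x hx y hy h
  · rintro x (hx | hx)
    · obtain ⟨y, hy, h⟩ := h₁.exists_norm_le x hx
      exact ⟨y, Finset.mem_union_left _ hy, h⟩
    · obtain ⟨y, hy, h⟩ := h₂.exists_norm_le x hx
      exact ⟨y, Finset.mem_union_right _ hy, h⟩
  · rw [Finset.disjoint_left]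
    intro x hx hx'
    have := hS x (h₁.subset x hx) x (h₂.subset x hx')
    rw [sub_self, norm_zero] at this
    exact absurd this (zpow_nonneg (norm_nonneg _) _).not_gt

theorem ultrametric_norm_add_le {F : Type*} [NormedField F] [IsUltrametricDist F] {x y : F} {c : ℝ}
    (hx : ‖x‖ ≤ c) (hy : ‖y‖ ≤ c) : ‖x + y‖ ≤ c :=
  (IsUltrametricDist.norm_add_le_max x y).trans (max_le hx hy)

theorem ultrametric_norm_sub_le {F : Type*} [NormedField F] [IsUltrametricDist F] {x y : F} {c : ℝ}
    (hx : ‖x‖ ≤ c) (hy : ‖y‖ ≤ c) : ‖x - y‖ ≤ c := by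
  rw [sub_eq_add_neg]
  exact ultrametric_norm_add_le hx (by rwa [norm_neg])

/-- A ball of radius `‖ϖ‖ ^ k` has `q ^ j` classes modulo `ϖ ^ (k + j)`. -/
theorem exists_isTransversal_ball (p : ℕ) [Fact p.Prime] {F : Type*} [NormedField F]
    [NormedAlgebra ℚ_[p] F] [FiniteDimensional ℚ_[p] F] {ϖ : F} (hϖ : IsUniformizer ϖ)
    (y₀ : F) (k : ℤ) (j : ℕ) :
    ∃ Y, IsTransversal ϖ (k + j) {y | ‖y - y₀‖ ≤ ‖ϖ‖ ^ k} Y ∧ Y.card = residueCard p F ^ j := by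
  classical
  have hu := isUltrametricDist_of_padic p F
  have h0 := hϖ.norm_pos
  obtain ⟨-, R, hRcard, hR1, hR2, hR3⟩ := exists_residue_transversal p F hϖ
  induction j with
  | zero =>
    refine ⟨{y₀}, ⟨?_, ?_, ?_⟩, by simp⟩
    · simpa using (hϖ.zpow_pos k).le
    · simp
    · simp
  | succ j ih =>
    obtain ⟨Y, hY, hcard⟩ := ih
    have hle : ‖ϖ‖ ^ (k + (j + 1 : ℕ)) ≤ ‖ϖ‖ ^ (k + j) := by
      rw [hϖ.zpow_le_zpow_iff]; push_cast; omega
    have hle' : ‖ϖ‖ ^ (k + j) ≤ ‖ϖ‖ ^ k := by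
      rw [hϖ.zpow_le_zpow_iff]; omega
    have hsc : ∀ x : F, ‖ϖ ^ (k + j) * x‖ ≤ ‖ϖ‖ ^ (k + (j + 1 : ℕ)) ↔ ‖x‖ ≤ ‖ϖ‖ := by
      intro x
      rw [norm_mul, norm_zpow, show k + ((j + 1 : ℕ) : ℤ) = k + j + 1 by push_cast; ring,
        zpow_add_one₀ h0.ne', mul_le_mul_iff_right₀ (hϖ.zpow_pos _)]
    have hsm : ∀ x ∈ R, ‖ϖ ^ (k + j) * x‖ ≤ ‖ϖ‖ ^ (k + j) := by
      intro x hx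
      rw [norm_mul, norm_zpow]
      exact mul_le_of_le_one_right (hϖ.zpow_pos _).le (hR1 x hx)
    have hinj : ∀ x ∈ Y ×ˢ R, ∀ y ∈ Y ×ˢ R,
        ‖(x.1 + ϖ ^ (k + j) * x.2) - (y.1 + ϖ ^ (k + j) * y.2)‖ ≤ ‖ϖ‖ ^ (k + (j + 1 : ℕ)) →
        x = y := by
      rintro ⟨y, r⟩ hx ⟨y', r'⟩ hx' h
      obtain ⟨hy, hr⟩ := Finset.mem_product.mp hx
      obtain ⟨hy', hr'⟩ := Finset.mem_product.mp hx'
      have e1 : y = y' := by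
        refine hY.eq_of_norm_le y hy y' hy' ?_
        have : y - y' = ((y + ϖ ^ (k + j) * r) - (y' + ϖ ^ (k + j) * r')) +
          (ϖ ^ (k + j) * r' - ϖ ^ (k + j) * r) := by ring
        rw [this]
        exact ultrametric_norm_add_le (h.trans hle) (ultrametric_norm_sub_le (hsm _ hr') (hsm _ hr))
      subst e1
      rw [add_sub_add_left_eq_sub, ← mul_sub, hsc] at h
      rw [hR2 r hr r' hr' h]
    refine ⟨(Y ×ˢ R).image fun x => x.1 + ϖ ^ (k + j) * x.2, ⟨?_, ?_, ?_⟩, ?_⟩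
    · intro z hz
      obtain ⟨⟨y, r⟩, hx, rfl⟩ := Finset.mem_image.mp hz
      obtain ⟨hy, hr⟩ := Finset.mem_product.mp hx
      have h1 : ‖y - y₀‖ ≤ ‖ϖ‖ ^ k := hY.subset y hy
      change ‖y + ϖ ^ (k + j) * r - y₀‖ ≤ ‖ϖ‖ ^ k
      rw [add_sub_right_comm]
      exact ultrametric_norm_add_le h1 ((hsm _ hr).trans hle')
    · intro z hz w hw h
      obtain ⟨x, hx, rfl⟩ := Finset.mem_image.mp hz
      obtain ⟨y, hy, rfl⟩ := Finset.mem_image.mp hw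
      rw [hinj x hx y hy h]
    · intro x hx
      obtain ⟨y, hy, hxy⟩ := hY.exists_norm_le x hx
      have hne : ϖ ^ (k + j) ≠ 0 := zpow_ne_zero _ hϖ.1
      obtain ⟨r, hr, hxr⟩ := hR3 ((x - y) / ϖ ^ (k + j)) (by
        rw [norm_div, norm_zpow]
        exact div_le_one_of_le₀ hxy (hϖ.zpow_pos _).le)
      refine ⟨_, Finset.mem_image_of_mem _ (Finset.mk_mem_product hy hr), ?_⟩
      rw [← hsc, mul_sub, mul_div_cancel₀ _ hne] at hxr
      rwa [← sub_sub]
    · rw [Finset.card_image_of_injOn, Finset.card_product, hcard, hRcard, pow_succ]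
      intro x hx y hy h
      refine hinj x hx y hy ?_
      change (fun x : F × F => x.1 + ϖ ^ (k + j) * x.2) x = _ at h
      simp only at h
      rw [h, sub_self, norm_zero]
      exact (hϖ.zpow_pos _).le

/-! ### `GL_n(O_F)` as a compact open subgroup -/

section IntegralGroup

variable {F : Type*} [NormedField F]

theorem matrix_mul_norm_le_one [IsUltrametricDist F] {n : ℕ} {A B : Matrix (Fin n) (Fin n) F}
    (hA : ∀ i j, ‖A i j‖ ≤ 1) (hB : ∀ i j, ‖B i j‖ ≤ 1) (i j : Fin n) : ‖(A * B) i j‖ ≤ 1 := by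
  rw [Matrix.mul_apply]
  refine IsUltrametricDist.norm_sum_le_of_forall_le_of_nonneg zero_le_one fun k _ => ?_
  rw [norm_mul]
  exact mul_le_one₀ (hA i k) (norm_nonneg _) (hB k j)

/-- `GL_n(O_F)` as a subgroup. -/
def integralSubgroup (F : Type*) [NormedField F] [IsUltrametricDist F] (n : ℕ) :
    Subgroup (GL (Fin n) F) where
  carrier := integralGL F n
  one_mem' := by
    intro i j
    rw [inv_one, Units.val_one, Matrix.one_apply]
    split_ifs <;> simp
  mul_mem' := by
    intro g h hg hh i j
    rw [mul_inv_rev, Units.val_mul, Units.val_mul]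
    exact ⟨matrix_mul_norm_le_one (fun i j => (hg i j).1) (fun i j => (hh i j).1) i j,
      matrix_mul_norm_le_one (fun i j => (hh i j).2) (fun i j => (hg i j).2) i j⟩
  inv_mem' := by
    intro g hg i j
    rw [inv_inv]
    exact (hg i j).symm

theorem mem_integralSubgroup [IsUltrametricDist F] {n : ℕ} {g : GL (Fin n) F} :
    g ∈ integralSubgroup F n ↔ g ∈ integralGL F n :=
  Iff.rfl

theorem continuous_GL_val {n : ℕ} (i j : Fin n) :
    Continuous fun h : GL (Fin n) F => (h : Matrix (Fin n) (Fin n) F) i j :=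
  (Units.continuous_val).matrix_elem i j

theorem continuous_GL_inv {n : ℕ} (i j : Fin n) :
    Continuous fun h : GL (Fin n) F => ((h⁻¹ : GL (Fin n) F) : Matrix (Fin n) (Fin n) F) i j :=
  (Units.continuous_coe_inv).matrix_elem i j

theorem isOpen_integralGL [IsUltrametricDist F] (n : ℕ) : IsOpen (integralGL F n) := by
  have hO : IsOpen {x : F | ‖x‖ ≤ 1} := by
    have := IsUltrametricDist.isOpen_closedBall (0 : F) one_ne_zero
    simpa [Metric.closedBall] using this
  have : integralGL F n = ⋂ i, ⋂ j,
      {h : GL (Fin n) F | (h : Matrix (Fin n) (Fin n) F) i j ∈ {x : F | ‖x‖ ≤ 1}} ∩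
      {h : GL (Fin n) F | ((h⁻¹ : GL (Fin n) F) : Matrix (Fin n) (Fin n) F) i j ∈ {x : F | ‖x‖ ≤ 1}} := by
    ext h; simp [integralGL]
  rw [this]
  exact isOpen_iInter_of_finite fun i => isOpen_iInter_of_finite fun j =>
    (hO.preimage (continuous_GL_val i j)).inter (hO.preimage (continuous_GL_inv i j))

/-- The units carry the topology induced by `h ↦ (h, h⁻¹)`, whose image is cut out by closed
equations. Compactness of `GL_n(O_F)` and local compactness of `GL_n(F)` are both pulled back along
this map. -/
theorem isClosedEmbedding_GL_embed (n : ℕ) :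
    Topology.IsClosedEmbedding (Units.embedProduct (Matrix (Fin n) (Fin n) F)) := by
  refine ⟨Units.isEmbedding_embedProduct, ?_⟩
  have : Set.range (Units.embedProduct (Matrix (Fin n) (Fin n) F)) =
      {x | x.1 * x.2.unop = 1} ∩ {x | x.2.unop * x.1 = 1} := by
    ext ⟨x, y⟩
    constructor
    · rintro ⟨u, hu⟩
      rw [Units.embedProduct_apply, Prod.mk.injEq] at hu
      obtain ⟨rfl, rfl⟩ := hu
      simp
    · rintro ⟨h1, h2⟩
      exact ⟨⟨x, y.unop, h1, h2⟩, rfl⟩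
  rw [this]
  refine IsClosed.inter (isClosed_eq ?_ continuous_const) (isClosed_eq ?_ continuous_const)
  · exact continuous_fst.mul (MulOpposite.continuous_unop.comp continuous_snd)
  · exact (MulOpposite.continuous_unop.comp continuous_snd).mul continuous_fst

theorem isCompact_integralGL [ProperSpace F] (n : ℕ) : IsCompact (integralGL F n) := by
  have hO : IsCompact {x : F | ‖x‖ ≤ 1} := by
    have := isCompact_closedBall (0 : F) 1
    simpa [Metric.closedBall] using this
  have hM : IsCompact {A : Matrix (Fin n) (Fin n) F | ∀ i j, ‖A i j‖ ≤ 1} := by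
    have h1 := isCompact_univ_pi (fun _ : Fin n => isCompact_univ_pi fun _ : Fin n => hO)
    have h2 : {A : Matrix (Fin n) (Fin n) F | ∀ i j, ‖A i j‖ ≤ 1} =
        (Set.univ.pi fun _ : Fin n => Set.univ.pi fun _ : Fin n => {x : F | ‖x‖ ≤ 1}) := by
      ext A
      exact ⟨fun h i _ j _ => h i j, fun h i j => h i trivial j trivial⟩
    rw [h2]
    exact h1
  have : integralGL F n = Units.embedProduct (Matrix (Fin n) (Fin n) F) ⁻¹'
      ({A : Matrix (Fin n) (Fin n) F | ∀ i j, ‖A i j‖ ≤ 1} ×ˢ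
        (MulOpposite.unop ⁻¹' {A : Matrix (Fin n) (Fin n) F | ∀ i j, ‖A i j‖ ≤ 1})) := by
    ext h
    simp [integralGL, forall_and]
  rw [this]
  refine (isClosedEmbedding_GL_embed n).isCompact_preimage (hM.prod ?_)
  exact MulOpposite.opHomeomorph.symm.isClosedEmbedding.isCompact_preimage hM

theorem locallyCompactSpace_GL [ProperSpace F] (n : ℕ) : LocallyCompactSpace (GL (Fin n) F) := by
  have h1 : LocallyCompactSpace (Matrix (Fin n) (Fin n) F) :=
    inferInstanceAs (LocallyCompactSpace (Fin n → Fin n → F))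
  have h2 : LocallyCompactSpace (Matrix (Fin n) (Fin n) F)ᵐᵒᵖ :=
    MulOpposite.opHomeomorph.symm.isClosedEmbedding.locallyCompactSpace
  exact (isClosedEmbedding_GL_embed n).locallyCompactSpace

end IntegralGroup

/-! ### Integration over cosets of a compact open subgroup -/

section Haar

variable {G : Type*} [TopologicalSpace G] [Group G] [IsTopologicalGroup G] [LocallyCompactSpace G]
  [MeasurableSpace G] [BorelSpace G]

-- The Haar measure is not assumed regular, so its right translate is compared with it only on sets
-- with compact closure, where uniqueness up to a scalar still holds.
open Measure in
theorem measure_preimage_mul_right_of_isCompact (μ : Measure G) [μ.IsHaarMeasure] {C : Set G}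
    (hC : IsCompact (closure C)) (g : G) :
    μ ((· * g) ⁻¹' C) = modularCharacter g * μ C := by
  have h1 := measure_isMulInvariant_eq_smul_of_isCompact_closure (map (· * g) μ) μ hC
  rw [← modularCharacterFun_eq_haarScalarFactor μ g] at h1
  have h2 : map (· * g) μ C = μ ((· * g) ⁻¹' C) :=
    (Homeomorph.mulRight g).toMeasurableEquiv.map_apply C
  rw [← h2, h1]
  rfl

-- Right translation by a central element is also left translation, which preserves Haar measure.
open Measure in
theorem modularCharacter_eq_one_of_central {g : G} (hg : ∀ h, h * g = g * h) :
    modularCharacter g = 1 := by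
  change modularCharacterFun g = 1
  borelize G
  let μ : Measure G := haar
  rw [modularCharacterFun_eq_haarScalarFactor μ g]
  have : map (· * g) μ = μ := by
    simp_rw [hg]
    exact map_mul_left_eq_self μ g
  have h : ∀ ν : Measure G, [ν.IsHaarMeasure] → ν = μ → haarScalarFactor ν μ = 1 := by
    rintro ν _ rfl
    exact haarScalarFactor_self _
  exact h _ this

/-- A function which is invariant on the left under a compact open subgroup of volume one and is
supported on finitely many cosets, on which the modular character is trivial, integrates to a finite
sum. -/
theorem integral_eq_sum_of_cosets (μ : Measure G) [μ.IsHaarMeasure] {K : Subgroup G}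
    (hK : IsCompact (K : Set G)) (ho : IsOpen (K : Set G)) (h1 : μ K = 1)
    {f : G → ℂ} (hf : ∀ k ∈ K, ∀ h, f (k * h) = f h) (T : Finset G)
    (hmod : ∀ t ∈ T, Measure.modularCharacter t = 1)
    (hT : ∀ t ∈ T, ∀ t' ∈ T, t * t'⁻¹ ∈ K → t = t')
    (hs : ∀ h, f h ≠ 0 → ∃ t ∈ T, h * t⁻¹ ∈ K) :
    Integrable f μ ∧ ∫ h, f h ∂μ = ∑ t ∈ T, f t := by
  classical
  have hc : IsClosed (K : Set G) := K.isClosed_of_isOpen ho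
  have hmeas : ∀ t : G, MeasurableSet ((· * t⁻¹) ⁻¹' (K : Set G)) := fun t =>
    (ho.preimage (continuous_mul_const _)).measurableSet
  have hvol : ∀ t ∈ T, μ ((· * t⁻¹) ⁻¹' (K : Set G)) = 1 := by
    intro t ht
    rw [measure_preimage_mul_right_of_isCompact μ (by rwa [hc.closure_eq])]
    have : Measure.modularCharacter t⁻¹ = 1 := by
      have h2 := map_mul (Measure.modularCharacter (G := G)) t t⁻¹
      rwa [mul_inv_cancel, map_one, hmod t ht, one_mul, eq_comm] at h2
    rw [this, h1]
    simp
  have hfe : f = fun h => ∑ t ∈ T, ((· * t⁻¹) ⁻¹' (K : Set G)).indicator (fun _ => f t) h := by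
    ext h
    by_cases hh : ∃ t ∈ T, h * t⁻¹ ∈ K
    · obtain ⟨t, ht, hht⟩ := hh
      rw [Finset.sum_eq_single t]
      · rw [Set.indicator_of_mem (by exact hht), ← hf _ hht t, inv_mul_cancel_right]
      · intro t' ht' hne
        refine Set.indicator_of_notMem (fun h' => hne (hT t' ht' t ht ?_)) _
        have h'' : h * t'⁻¹ ∈ K := h'
        have := K.mul_mem (K.inv_mem h'') hht
        simpa [mul_assoc] using this
      · exact fun h' => absurd ht h'
    · rw [Finset.sum_eq_zero]
      · by_contra hne
        exact hh (hs h hne)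
      · exact fun t ht => Set.indicator_of_notMem
          (fun h' : h ∈ (· * t⁻¹) ⁻¹' (K : Set G) => hh ⟨t, ht, h'⟩) _
  have hint : ∀ t ∈ T, Integrable
      (((· * t⁻¹) ⁻¹' (K : Set G)).indicator (fun _ => f t)) μ := by
    intro t ht
    refine (integrable_indicator_iff (hmeas t)).mpr (integrableOn_const ?_ ?_)
    · rw [hvol t ht]; exact ENNReal.one_ne_top
    · simp
  constructor
  · rw [hfe]
    exact integrable_finsetSum _ hint
  · conv_lhs => rw [hfe]
    rw [integral_finsetSum _ hint]
    refine Finset.sum_congr rfl fun t ht => ?_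
    rw [integral_indicator_const _ (hmeas t), measureReal_def, hvol t ht]
    simp

end Haar

/-! ### Upper triangular matrices and triviality of the modular character -/

section UpperTriangular

variable {F : Type*} [Field F]

/-- The upper triangular matrix with diagonal entries `x, z` and off-diagonal entry `y`. -/
def upperGL (x z : Fˣ) (y : F) : GL (Fin 2) F where
  val := !![(x : F), y; 0, (z : F)]
  inv := !![((x⁻¹ : Fˣ) : F), -(x⁻¹ : Fˣ) * y * (z⁻¹ : Fˣ); 0, ((z⁻¹ : Fˣ) : F)]
  val_inv := by
    simp [Matrix.one_fin_two, mul_assoc]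
  inv_val := by
    simp [Matrix.one_fin_two]

theorem upperGL_mul (x z x' z' : Fˣ) (y y' : F) :
    upperGL x z y * upperGL x' z' y' = upperGL (x * x') (z * z') (x * y' + y * z') := by
  ext i j
  fin_cases i <;> fin_cases j <;> simp [upperGL]

/-- The permutation matrix exchanging the two coordinates. -/
def swapGL : GL (Fin 2) F where
  val := !![0, 1; 1, 0]
  inv := !![0, 1; 1, 0]
  val_inv := by simp [Matrix.one_fin_two]
  inv_val := by simp [Matrix.one_fin_two]

theorem swapGL_mul_upperGL (x z : Fˣ) :
    swapGL * upperGL x z 0 = upperGL z x 0 * swapGL := by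
  ext i j
  fin_cases i <;> fin_cases j <;> simp [upperGL, swapGL]

theorem mul_upperGL_scalar (x : Fˣ) (h : GL (Fin 2) F) :
    h * upperGL x x 0 = upperGL x x 0 * h := by
  ext i j
  fin_cases i <;> fin_cases j <;>
    simp [upperGL, Matrix.mul_apply, Fin.sum_univ_two, mul_comm]

theorem upperGL_one : upperGL (1 : Fˣ) 1 (0 : F) = 1 := by
  ext i j
  fin_cases i <;> fin_cases j <;> simp [upperGL]

/-- A character is constant on conjugacy classes. Swapping coordinates conjugates `diag(x, z)` to
`diag(z, x)`, and their product is scalar; conjugation by `diag(-1, 1)` inverts a unipotent. In both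
cases `χ² = 1`, hence `χ = 1` because the values are nonnegative reals. -/
theorem map_upperGL_eq_one (χ : GL (Fin 2) F →* NNReal)
    (hs : ∀ x : Fˣ, χ (upperGL x x 0) = 1) (x z : Fˣ) (y : F) : χ (upperGL x z y) = 1 := by
  have key : ∀ g g' k : GL (Fin 2) F, k * g = g' * k → χ (g * g') = 1 → χ g = 1 := by
    intro g g' k hk hg
    have h0 : χ k ≠ 0 := ((Group.isUnit k).map χ).ne_zero
    have h1 : χ g = χ g' := by
      have := congrArg χ hk
      rw [map_mul, map_mul, mul_comm] at this
      exact mul_right_cancel₀ h0 this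
    rw [map_mul, ← h1, ← sq] at hg
    exact (pow_eq_one_iff_of_nonneg zero_le two_ne_zero).mp hg
  have hdiag : χ (upperGL x z 0) = 1 := by
    refine key _ _ _ (swapGL_mul_upperGL x z) ?_
    rw [upperGL_mul, mul_comm z x]
    simpa using hs (x * z)
  have hunip : χ (upperGL 1 1 ((x⁻¹ : Fˣ) * y)) = 1 := by
    refine key _ (upperGL 1 1 (-((x⁻¹ : Fˣ) * y))) (upperGL (-1) 1 0) ?_ ?_
    · rw [upperGL_mul, upperGL_mul]; simp
    · rw [upperGL_mul]; simp [upperGL_one]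
  have : upperGL x z y = upperGL x z 0 * upperGL 1 1 ((x⁻¹ : Fˣ) * y) := by
    rw [upperGL_mul]; simp
  rw [this, map_mul, hdiag, hunip, one_mul]

end UpperTriangular

/-! ### Iwasawa decomposition and reduction to a finite sum -/

section Iwasawa

variable {F : Type*} [NormedField F]

theorem upperGL_inv (x z : Fˣ) (y : F) :
    (upperGL x z y)⁻¹ = upperGL x⁻¹ z⁻¹ (-(x⁻¹ : Fˣ) * y * (z⁻¹ : Fˣ)) := by
  rw [inv_eq_iff_mul_eq_one, upperGL_mul]
  simp [upperGL_one, mul_assoc]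

theorem upperGL_val (x z : Fˣ) (y : F) :
    (upperGL x z y : Matrix (Fin 2) (Fin 2) F) = !![(x : F), y; 0, (z : F)] :=
  rfl

theorem upperGL_inv_val (x z : Fˣ) (y : F) :
    ((upperGL x z y)⁻¹ : GL (Fin 2) F).val =
      !![((x⁻¹ : Fˣ) : F), -(x⁻¹ : Fˣ) * y * (z⁻¹ : Fˣ); 0, ((z⁻¹ : Fˣ) : F)] :=
  rfl

theorem upperGL_mem_integralGL {x z : Fˣ} {y : F} :
    upperGL x z y ∈ integralGL F 2 ↔ ‖(x : F)‖ = 1 ∧ ‖(z : F)‖ = 1 ∧ ‖y‖ ≤ 1 := by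
  have hone : ∀ u : Fˣ, (‖(u : F)‖ ≤ 1 ∧ ‖((u⁻¹ : Fˣ) : F)‖ ≤ 1) ↔ ‖(u : F)‖ = 1 := by
    intro u
    have hu : 0 < ‖(u : F)‖ := norm_pos_iff.mpr u.ne_zero
    rw [Units.val_inv_eq_inv_val, norm_inv, inv_le_one₀ hu, le_antisymm_iff]
  rw [← hone x, ← hone z]
  constructor
  · intro h
    have h00 := h 0 0
    have h01 := h 0 1
    have h11 := h 1 1
    rw [upperGL_val, upperGL_inv_val] at h00 h01 h11
    exact ⟨h00, h11, h01.1⟩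
  · rintro ⟨h1, h3, h2⟩
    have h4 : ‖-((x⁻¹ : Fˣ) : F) * y * (z⁻¹ : Fˣ)‖ ≤ 1 := by
      rw [norm_mul, norm_mul, norm_neg]
      exact mul_le_one₀ (mul_le_one₀ h1.2 (norm_nonneg _) h2) (norm_nonneg _) h3.2
    have h0 : ‖(0 : F)‖ ≤ 1 ∧ ‖(0 : F)‖ ≤ 1 := by simp
    intro i j
    rw [upperGL_val, upperGL_inv_val]
    fin_cases i <;> fin_cases j
    exacts [h1, ⟨h2, h4⟩, h0, h3]

theorem upperGL_mul_inv (x z x' z' : Fˣ) (y y' : F) :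
    upperGL x z y * (upperGL x' z' y')⁻¹ =
      upperGL (x * x'⁻¹) (z * z'⁻¹) ((y - x * (x'⁻¹ : Fˣ) * y') * (z'⁻¹ : Fˣ)) := by
  rw [upperGL_inv, upperGL_mul]
  congr 1
  ring

theorem swapGL_mem_integralGL : (swapGL : GL (Fin 2) F) ∈ integralGL F 2 := by
  intro i j
  have : (swapGL : GL (Fin 2) F)⁻¹ = swapGL := rfl
  rw [this]
  fin_cases i <;> fin_cases j <;> simp [swapGL]

/-- The lower unipotent matrix with off-diagonal entry `t`. -/
def lowerUnipotent (t : F) : GL (Fin 2) F where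
  val := !![1, 0; t, 1]
  inv := !![1, 0; -t, 1]
  val_inv := by simp [Matrix.one_fin_two]
  inv_val := by simp [Matrix.one_fin_two]

theorem lowerUnipotent_mem_integralGL {t : F} (ht : ‖t‖ ≤ 1) :
    lowerUnipotent t ∈ integralGL F 2 := by
  intro i j
  have : (lowerUnipotent t)⁻¹ = lowerUnipotent (-t) := Units.ext rfl
  rw [this]
  fin_cases i <;> fin_cases j <;> simp [lowerUnipotent, ht]

/-- Iwasawa decomposition for `GL_2`. -/
theorem exists_mul_upperGL_inv_mem [IsUltrametricDist F] {ϖ : Fˣ} (hϖ : IsUniformizer (ϖ : F))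
    (h : GL (Fin 2) F) :
    ∃ (m n : ℤ) (y : F), h * (upperGL (ϖ ^ m) (ϖ ^ n) y)⁻¹ ∈ integralSubgroup F 2 := by
  have hup : ∀ (x z : Fˣ) (y : F), ∃ (m n : ℤ) (y' : F),
      upperGL x z y * (upperGL (ϖ ^ m) (ϖ ^ n) y')⁻¹ ∈ integralSubgroup F 2 := by
    intro x z y
    obtain ⟨m, hm⟩ := hϖ.exists_norm_eq_zpow x.ne_zero
    obtain ⟨n, hn⟩ := hϖ.exists_norm_eq_zpow z.ne_zero
    refine ⟨m, n, ϖ ^ m * (x⁻¹ : Fˣ) * y, ?_⟩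
    have hp := hϖ.norm_pos.ne'
    rw [upperGL_mul_inv, mem_integralSubgroup, upperGL_mem_integralGL]
    have h1 : ∀ k : ℤ, ‖ϖ.val‖ ^ k ≠ 0 := fun k => zpow_ne_zero _ hp
    refine ⟨by simp [hm, h1], by simp [hn, h1], ?_⟩
    have h2 : (x : F) * ((ϖ ^ m)⁻¹ : Fˣ) * (ϖ ^ m * (x⁻¹ : Fˣ) * y) = y := by
      simp only [Units.val_inv_eq_inv_val, Units.val_zpow_eq_zpow_val]
      have h3 : (ϖ : F) ^ m ≠ 0 := zpow_ne_zero _ hϖ.1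
      have h4 := x.ne_zero
      field_simp
    rw [h2, sub_self, zero_mul, norm_zero]
    exact zero_le_one
  have hK : ∀ k ∈ integralGL F 2, (∃ (m n : ℤ) (y : F),
      k * h * (upperGL (ϖ ^ m) (ϖ ^ n) y)⁻¹ ∈ integralSubgroup F 2) →
      ∃ (m n : ℤ) (y : F), h * (upperGL (ϖ ^ m) (ϖ ^ n) y)⁻¹ ∈ integralSubgroup F 2 := by
    rintro k hk ⟨m, n, y, hy⟩
    refine ⟨m, n, y, ?_⟩
    rw [mul_assoc] at hy
    exact ((integralSubgroup F 2).mul_mem_cancel_left hk).mp hy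
  -- With the larger entry of the first column on the diagonal, the quotient needed for row
  -- elimination is integral; the other case is reduced to this one by a swap.
  have hpiv : ∀ g : GL (Fin 2) F, ‖(g : Matrix (Fin 2) (Fin 2) F) 1 0‖ ≤ ‖g.val 0 0‖ →
      ∃ k ∈ integralGL F 2, ∃ x z y, k * g = upperGL x z y := by
    intro g hg
    have hdet : g.val.det ≠ 0 := by
      have := (Matrix.isUnit_iff_isUnit_det _).mp g.isUnit
      exact this.ne_zero
    rw [Matrix.det_fin_two] at hdet
    have h0 : g.val 0 0 ≠ 0 := by
      intro h0
      rw [h0, norm_zero, norm_le_zero_iff] at hg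
      simp [h0, hg] at hdet
    have hz : g.val 1 1 - g.val 1 0 / g.val 0 0 * g.val 0 1 ≠ 0 := by
      intro hz
      apply hdet
      field_simp at hz
      linear_combination hz
    refine ⟨lowerUnipotent (-(g.val 1 0 / g.val 0 0)), lowerUnipotent_mem_integralGL ?_,
      Units.mk0 _ h0, Units.mk0 _ hz, g.val 0 1, ?_⟩
    · rw [norm_neg, norm_div]
      exact div_le_one_of_le₀ hg (norm_nonneg _)
    · ext i j
      fin_cases i <;> fin_cases j <;>
        simp [lowerUnipotent, upperGL, Matrix.mul_apply, Fin.sum_univ_two, h0]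
      ring
  rcases le_total ‖h.val 1 0‖ ‖h.val 0 0‖ with hle | hle
  · obtain ⟨k, hk, x, z, y, he⟩ := hpiv h hle
    refine hK k hk ?_
    rw [he]
    exact hup x z y
  · obtain ⟨k, hk, x, z, y, he⟩ := hpiv (swapGL * h) (by
      simpa [swapGL, Matrix.mul_apply, Fin.sum_univ_two] using hle)
    refine hK (k * swapGL) ((integralSubgroup F 2).mul_mem hk swapGL_mem_integralGL) ?_
    rw [mul_assoc, he]
    exact hup x z y

/-- Left translation by an integral unipotent with entry `t` shifts `y` by `t ϖ^n`, so the
off-diagonal entry is determined exactly modulo `ϖ^n O_F`. -/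
theorem upperGL_zpow_mul_inv_mem_iff [IsUltrametricDist F] {ϖ : Fˣ} (hϖ : IsUniformizer (ϖ : F))
    {m n m' n' : ℤ} {y y' : F} :
    upperGL (ϖ ^ m) (ϖ ^ n) y * (upperGL (ϖ ^ m') (ϖ ^ n') y')⁻¹ ∈ integralSubgroup F 2 ↔
      m = m' ∧ n = n' ∧ ‖y - y'‖ ≤ ‖(ϖ : F)‖ ^ n := by
  have h0 := hϖ.norm_pos.ne'
  have key : ∀ k l : ℤ, ‖((ϖ ^ k * (ϖ ^ l)⁻¹ : Fˣ) : F)‖ = 1 ↔ k = l := by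
    intro k l
    rw [← zpow_neg, ← zpow_add, Units.val_zpow_eq_zpow_val, norm_zpow]
    constructor
    · intro h
      have := hϖ.zpow_inj (n := 0) (by rw [h, zpow_zero])
      omega
    · rintro rfl
      simp
  rw [upperGL_mul_inv, mem_integralSubgroup, upperGL_mem_integralGL, key, key]
  refine and_congr_right fun hm => and_congr_right fun hn => ?_
  subst hm hn
  rw [← Units.val_mul, mul_inv_cancel, Units.val_one, one_mul, ← zpow_neg,
    Units.val_zpow_eq_zpow_val, norm_mul, norm_zpow, zpow_neg,
    mul_inv_le_iff₀ (hϖ.zpow_pos n), one_mul]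

/-- Integration of a left `GL_2(O_F)`-invariant function with finite support modulo `GL_2(O_F)`. -/
theorem integral_GL_two_eq_sum [ProperSpace F] [IsUltrametricDist F] {ϖ : Fˣ} (hϖ : IsUniformizer (ϖ : F))
    [MeasurableSpace (GL (Fin 2) F)]
    [BorelSpace (GL (Fin 2) F)] (μ : Measure (GL (Fin 2) F)) [μ.IsHaarMeasure]
    (hμ : μ (integralGL F 2) = 1) {f : GL (Fin 2) F → ℂ}
    (hf : ∀ k ∈ integralGL F 2, ∀ h, f (k * h) = f h) {κ : Type*} (ι : Finset κ) (m n : κ → ℤ)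
    (hinj : ∀ i ∈ ι, ∀ j ∈ ι, m i = m j → n i = n j → i = j) (Y : κ → Finset F)
    (hY : ∀ i ∈ ι, IsTransversal (ϖ : F) (n i)
      {y | f (upperGL (ϖ ^ m i) (ϖ ^ n i) y) ≠ 0} (Y i))
    (hsupp : ∀ (k l : ℤ) (y : F), f (upperGL (ϖ ^ k) (ϖ ^ l) y) ≠ 0 →
      ∃ i ∈ ι, m i = k ∧ n i = l) :
    Integrable f μ ∧
      ∫ h, f h ∂μ = ∑ i ∈ ι, ∑ y ∈ Y i, f (upperGL (ϖ ^ m i) (ϖ ^ n i) y) := by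
  classical
  have := locallyCompactSpace_GL (F := F) 2
  have hKc : IsCompact (integralSubgroup F 2 : Set (GL (Fin 2) F)) := isCompact_integralGL 2
  have hKo : IsOpen (integralSubgroup F 2 : Set (GL (Fin 2) F)) := isOpen_integralGL 2
  have hinj' : ∀ x ∈ ι.sigma Y, ∀ x' ∈ ι.sigma Y,
      upperGL (ϖ ^ m x.1) (ϖ ^ n x.1) x.2 * (upperGL (ϖ ^ m x'.1) (ϖ ^ n x'.1) x'.2)⁻¹ ∈
        integralSubgroup F 2 → x = x' := by
    rintro ⟨i, y⟩ hx ⟨j, y'⟩ hx' h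
    obtain ⟨hi, hy⟩ := Finset.mem_sigma.mp hx
    obtain ⟨hj, hy'⟩ := Finset.mem_sigma.mp hx'
    obtain ⟨h1, h2, h3⟩ := (upperGL_zpow_mul_inv_mem_iff hϖ).mp h
    obtain rfl : i = j := hinj i hi j hj h1 h2
    obtain rfl : y = y' := (hY i hi).eq_of_norm_le y hy y' hy' h3
    rfl
  have hsum := integral_eq_sum_of_cosets μ hKc hKo hμ (f := f) hf
    ((ι.sigma Y).image fun x => upperGL (ϖ ^ m x.1) (ϖ ^ n x.1) x.2) ?_ ?_ ?_
  · refine ⟨hsum.1, hsum.2.trans ?_⟩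
    rw [Finset.sum_image, Finset.sum_sigma]
    intro x hx x' hx' h
    refine hinj' x hx x' hx' ?_
    simp only at h
    rw [h, mul_inv_cancel]
    exact one_mem _
  · intro t ht
    obtain ⟨x, -, rfl⟩ := Finset.mem_image.mp ht
    refine map_upperGL_eq_one _ ?_ _ _ _
    exact fun x => modularCharacter_eq_one_of_central (mul_upperGL_scalar x)
  · intro t ht t' ht' h
    obtain ⟨x, hx, rfl⟩ := Finset.mem_image.mp ht
    obtain ⟨x', hx', rfl⟩ := Finset.mem_image.mp ht'
    rw [hinj' x hx x' hx' h]
  · intro h hh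
    obtain ⟨k, l, y, hk⟩ := exists_mul_upperGL_inv_mem hϖ h
    have hfh : f (upperGL (ϖ ^ k) (ϖ ^ l) y) = f h := by
      rw [← hf _ hk, inv_mul_cancel_right]
    rw [← hfh] at hh
    obtain ⟨i, hi, rfl, rfl⟩ := hsupp k l y hh
    obtain ⟨y', hy', hyy'⟩ := (hY i hi).exists_norm_le y hh
    refine ⟨_, Finset.mem_image_of_mem _ (Finset.mem_sigma.mpr ⟨hi, hy'⟩ : ⟨i, y'⟩ ∈ ι.sigma Y), ?_⟩
    have h2 := (integralSubgroup F 2).mul_mem hk ((upperGL_zpow_mul_inv_mem_iff hϖ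
      (m := m i)).mpr ⟨rfl, rfl, hyy'⟩)
    simpa only [mul_assoc, inv_mul_cancel_left] using h2

end Iwasawa

/-! ### The Galois action, the matching condition and the shape of the triple -/

/-- An automorphism is a bounded linear map over a complete field. If it increased one norm, the
powers of that element would increase theirs by unbounded factors. -/
theorem norm_algEquiv_apply {F E : Type*} [NormedField F] [CompleteSpace F] [NormedField E]
    [NormedAlgebra F E] [FiniteDimensional F E] {ϖ : F} (hϖ : IsUniformizer ϖ) (σ : E ≃ₐ[F] E)
    (x : E) : ‖σ x‖ = ‖x‖ := by
  let _ : NontriviallyNormedField F :=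
    NontriviallyNormedField.ofNormNeOne ⟨ϖ, hϖ.1, hϖ.2.1.ne⟩
  have key : ∀ (τ : E ≃ₐ[F] E) (x : E), ‖τ x‖ ≤ ‖x‖ := by
    intro τ x
    let T : E →L[F] E := LinearMap.toContinuousLinearMap (τ : E ≃ₐ[F] E).toLinearMap
    have hT : ∀ y, ‖τ y‖ ≤ ‖T‖ * ‖y‖ := fun y => T.le_opNorm y
    rcases eq_or_ne x 0 with rfl | hx
    · simp
    by_contra! hlt
    have hx0 : 0 < ‖x‖ := norm_pos_iff.mpr hx
    have h1 : 1 < ‖τ x‖ / ‖x‖ := (one_lt_div hx0).mpr hlt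
    obtain ⟨n, hn⟩ := pow_unbounded_of_one_lt ‖T‖ h1
    have h2 := hT (x ^ n)
    rw [map_pow, norm_pow, norm_pow, ← div_le_iff₀ (pow_pos hx0 n), ← div_pow] at h2
    exact absurd h2 hn.not_ge
  refine le_antisymm (key σ x) ?_
  simpa using key σ.symm (σ x)

/-- A fixed element outside `F` would form an `F`-basis together with `1`, forcing `σ` to be
trivial. -/
theorem exists_algebraMap_eq_of_fixed {F E : Type*} [Field F] [Field E] [Algebra F E]
    (h2 : Module.finrank F E = 2) {σ : E ≃ₐ[F] E} (hσ : σ ≠ 1) {x : E} (hx : σ x = x) :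
    ∃ y : F, algebraMap F E y = x := by
  by_contra! hne
  apply hσ
  have hli : LinearIndependent F ![1, x] := by
    rw [LinearIndependent.pair_iff]
    intro s t hst
    have ht : t = 0 := by
      by_contra ht
      apply hne (-(s / t))
      have h3 : algebraMap F E t ≠ 0 := by simpa using ht
      rw [Algebra.smul_def, Algebra.smul_def, mul_one] at hst
      rw [map_neg, map_div₀]
      field_simp
      linear_combination -hst
    subst ht
    simpa [Algebra.smul_def] using hst
  have hspan : ⊤ ≤ Submodule.span F (Set.range ![1, x]) := by
    have : FiniteDimensional F E := Module.finite_of_finrank_eq_succ h2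
    rw [top_le_iff]
    exact hli.span_eq_top_of_card_eq_finrank (by simp [h2])
  ext z
  have hz : z ∈ Submodule.span F (Set.range ![1, x]) := hspan trivial
  rw [Matrix.range_cons, Matrix.range_cons, Matrix.range_empty, Set.union_empty,
    Set.singleton_union, Submodule.mem_span_pair] at hz
  obtain ⟨s, t, rfl⟩ := hz
  simp [hx]

theorem algEquiv_apply_apply_of_finrank_two {F E : Type*} [Field F] [Field E] [Algebra F E]
    (h2 : Module.finrank F E = 2) (σ : E ≃ₐ[F] E) (x : E) : σ (σ x) = x := by
  have : FiniteDimensional F E := Module.finite_of_finrank_eq_succ h2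
  have hcard : Fintype.card (E ≃ₐ[F] E) ≤ 2 := by
    rw [← h2]
    exact AlgEquiv.card_le
  by_cases h1 : σ = 1
  · simp [h1]
  have h3 : orderOf σ ≤ 2 := orderOf_le_card_univ.trans hcard
  have h4 : orderOf σ = 2 := by
    have := orderOf_pos σ
    have : orderOf σ ≠ 1 := fun h => h1 (orderOf_eq_one_iff.mp h)
    omega
  have h5 : σ ^ 2 = 1 := by rw [← h4]; exact pow_orderOf_eq_one σ
  have := congrArg (fun τ : E ≃ₐ[F] E => τ x) h5
  simpa [sq] using this

theorem symmSpace_two_relations {F E : Type*} [Field F] [Field E] [Algebra F E] {σ : E ≃ₐ[F] E}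
    {a b c d : E} (h : !![a, b; c, d] ∈ symmSpace σ 2) :
    a * σ a + b * σ c = 1 ∧ a * σ b + b * σ d = 0 ∧ c * σ a + d * σ c = 0 ∧
      c * σ b + d * σ d = 1 := by
  have h' : !![a, b; c, d] * (!![a, b; c, d]).map σ = 1 := h
  have h2 := fun i j => congrFun (congrFun h' i) j
  refine ⟨by simpa [Matrix.mul_apply] using h2 0 0, by simpa [Matrix.mul_apply] using h2 0 1,
    by simpa [Matrix.mul_apply] using h2 1 0, by simpa [Matrix.mul_apply] using h2 1 1⟩

theorem linearIndependent_pow_mulVec_two_iff {K : Type*} [Field K] (g : Matrix (Fin 2) (Fin 2) K)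
    (w : Fin 2 → K) : LinearIndependent K (fun i : Fin 2 => (g ^ (i : ℕ)) *ᵥ w) ↔
      w 0 * (g *ᵥ w) 1 - w 1 * (g *ᵥ w) 0 ≠ 0 := by
  have h : (fun i : Fin 2 => (g ^ (i : ℕ)) *ᵥ w) =
      (!![w 0, w 1; (g *ᵥ w) 0, (g *ᵥ w) 1] : Matrix (Fin 2) (Fin 2) K).row := by
    ext i j
    fin_cases i <;> fin_cases j <;> simp
  rw [h, Matrix.linearIndependent_rows_iff_isUnit, Matrix.isUnit_iff_isUnit_det,
    Matrix.det_fin_two_of, isUnit_iff_ne_zero]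

theorem linearIndependent_vecMul_pow_two_iff {K : Type*} [Field K] (g : Matrix (Fin 2) (Fin 2) K)
    (v : Fin 2 → K) : LinearIndependent K (fun i : Fin 2 => v ᵥ* (g ^ (i : ℕ))) ↔
      v 0 * (v ᵥ* g) 1 - v 1 * (v ᵥ* g) 0 ≠ 0 := by
  have h : (fun i : Fin 2 => v ᵥ* (g ^ (i : ℕ))) =
      (!![v 0, v 1; (v ᵥ* g) 0, (v ᵥ* g) 1] : Matrix (Fin 2) (Fin 2) K).row := by
    ext i j
    fin_cases i <;> fin_cases j <;> simp
  rw [h, Matrix.linearIndependent_rows_iff_isUnit, Matrix.isUnit_iff_isUnit_det,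
    Matrix.det_fin_two_of, isUnit_iff_ne_zero]

theorem adjointCovector_dotProduct {F E : Type*} [Field F] [Field E] [Algebra F E] (σ : E ≃ₐ[F] E)
    (ϖ : F) (w x : Fin 2 → E) :
    adjointCovector σ ϖ w ⬝ᵥ x = σ (w 0) * x 0 - algebraMap F E ϖ * σ (w 1) * x 1 := by
  simp [adjointCovector, nonsplitGram, Matrix.vecMul, dotProduct, Fin.sum_univ_two]
  ring

theorem unitarySet_dotProduct {F E : Type*} [Field F] [Field E] [Algebra F E] {σ : E ≃ₐ[F] E}
    {ϖ : F} {g : Matrix (Fin 2) (Fin 2) E} (hg : g ∈ unitarySet σ ϖ) (w x : Fin 2 → E) :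
    adjointCovector σ ϖ (g *ᵥ w) ⬝ᵥ (g *ᵥ x) = adjointCovector σ ϖ w ⬝ᵥ x := by
  have h1 : (fun i => σ ((g *ᵥ w) i)) = (fun i => σ (w i)) ᵥ* (g.map σ)ᵀ := by
    ext i
    fin_cases i <;> simp [Matrix.mulVec, Matrix.vecMul, dotProduct, Fin.sum_univ_two, mul_comm]
  have hg' : (g.map σ)ᵀ * nonsplitGram E ϖ * g = nonsplitGram E ϖ := hg
  rw [adjointCovector, h1, Matrix.dotProduct_mulVec, Matrix.vecMul_vecMul, Matrix.vecMul_vecMul,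
    ← mul_assoc, hg', adjointCovector]

/-- The consequences of matching with the non-split Hermitian plane: the Gram determinant of `w, gw`
is `-ϖ` times a norm. -/
theorem rsMinus_gram {F E : Type*} [Field F] [Field E] [Algebra F E] {σ : E ≃ₐ[F] E}
    (hσ2 : ∀ x, σ (σ x) = x) {ϖ : F} {a b c d : E} {e : F}
    (h : ((!![a, b; c, d], ![0, 1], ![0, e]) :
      Matrix (Fin 2) (Fin 2) E × (Fin 2 → F) × (Fin 2 → F)) ∈ rsMinus σ ϖ) :
    b ≠ 0 ∧ c ≠ 0 ∧ e ≠ 0 ∧ ∃ z : E, z ≠ 0 ∧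
      algebraMap F E e ^ 2 * (1 - d * σ d) = -(algebraMap F E ϖ) * (z * σ z) := by
  obtain ⟨-, ⟨hu, hv⟩, g, hg, w, ⟨hw, -⟩, P, hPγ, hPu, hPv⟩ := h
  rw [linearIndependent_pow_mulVec_two_iff] at hu hw
  rw [linearIndependent_vecMul_pow_two_iff] at hv
  simp only [Matrix.mulVec, Matrix.vecMul, dotProduct, Fin.sum_univ_two, Matrix.of_apply,
    Matrix.cons_val', Matrix.cons_val_zero, Matrix.cons_val_one, Matrix.cons_val_fin_one,
    map_zero, map_one, zero_mul, mul_zero, zero_add, mul_one, one_mul, zero_sub, neg_ne_zero,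
    mul_ne_zero_iff, ne_eq, map_eq_zero] at hu hv
  refine ⟨hu, hv.2.2, hv.1, _, hw, ?_⟩
  have hinv : ((P⁻¹ : GL (Fin 2) E) : Matrix (Fin 2) (Fin 2) E) * (P : Matrix (Fin 2) (Fin 2) E) =
      1 := P.inv_mul
  -- Conjugation by `P` transports the pairings: `⟨w, w⟩ = e` and `⟨gw, w⟩ = e d`, while `⟨gw, gw⟩ =
  -- e` by unitarity.
  have e1 : adjointCovector σ ϖ w ⬝ᵥ w = algebraMap F E e := by
    rw [← hPv]
    nth_rw 1 [← hPu]
    rw [Matrix.dotProduct_mulVec, Matrix.vecMul_vecMul, hinv, Matrix.vecMul_one]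
    simp [dotProduct, Fin.sum_univ_two]
  have e2 : adjointCovector σ ϖ w ⬝ᵥ (g *ᵥ w) = algebraMap F E e * d := by
    rw [← hPv]
    nth_rw 1 [← hPu]
    rw [← hPγ, Matrix.mulVec_mulVec, mul_assoc, hinv, mul_one, Matrix.dotProduct_mulVec,
      Matrix.vecMul_vecMul, ← mul_assoc, hinv, one_mul, ← Matrix.dotProduct_mulVec]
    simp [dotProduct, Fin.sum_univ_two, Matrix.mulVec]
  have e3 := (unitarySet_dotProduct hg w w).trans e1
  have e4 := congrArg σ e2
  rw [adjointCovector_dotProduct] at e1 e2 e3 e4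
  simp only [map_sub, map_mul, hσ2, AlgEquiv.commutes] at e4 ⊢
  set W := g *ᵥ w
  -- The Gram determinant of `w, gw` is the discriminant `-ϖ` times the norm of the coordinate
  -- determinant `z`; the combination substitutes the three pairings into this identity.
  linear_combination (-algebraMap F E e) * e1 - (σ (w 0) * w 0 - algebraMap F E ϖ * σ (w 1) * w 1)
    * e3 + (w 0 * σ (W 0) - algebraMap F E ϖ * w 1 * σ (W 1)) * e2 +
      algebraMap F E e * d * e4

theorem norm_add_eq_left {F : Type*} [NormedField F] [IsUltrametricDist F] {x y : F}
    (h : ‖y‖ < ‖x‖) : ‖x + y‖ = ‖x‖ := by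
  rw [IsUltrametricDist.norm_add_eq_max_of_norm_ne_norm h.ne', max_eq_left h.le]

/-- The structure of the triples in `rsMinus` of the shape considered here: up to the scalar `c`, the
entries `b` and `d - a` lie in `F`. -/
theorem rsMinus_structure {F E : Type*} [NormedField F] [CompleteSpace F] [NormedField E]
    [IsUltrametricDist E] [NormedAlgebra F E] (hE : IsUnramifiedQuadratic F E)
    {σ : E ≃ₐ[F] E} (hσ : σ ≠ 1) {ϖ : F} (hϖ : IsUniformizer ϖ) {a b c d : E} {e : F}
    (h : ((!![a, b; c, d], ![0, 1], ![0, e]) :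
      Matrix (Fin 2) (Fin 2) E × (Fin 2 → F) × (Fin 2 → F)) ∈ rsMinus σ ϖ) :
    b ≠ 0 ∧ c ≠ 0 ∧ e ≠ 0 ∧ ‖a‖ ≤ 1 ∧ ‖d‖ ≤ 1 ∧ Odd (val ϖ b + val ϖ c) ∧
      0 < val ϖ b + val ϖ c ∧ ∃ A B : F, algebraMap F E A * c = d - a ∧ algebraMap F E B * c = b := by
  have h2 := hE.finrank_eq_two
  have : FiniteDimensional F E := Module.finite_of_finrank_eq_succ h2
  have hσ2 := algEquiv_apply_apply_of_finrank_two h2 σ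
  have hn := norm_algEquiv_apply hϖ σ
  have hϖE := hE.isUniformizer_map ϖ hϖ
  obtain ⟨hb, hc, he, z, hz, hgram⟩ := rsMinus_gram hσ2 h
  obtain ⟨r1, r2, r3, r4⟩ := symmSpace_two_relations h.1
  have r3' := congrArg σ r3
  have r4' := congrArg σ r4
  simp only [map_add, map_mul, hσ2, map_zero, map_one] at r3' r4'
  have h0 := hϖ.norm_pos.ne'
  have hbc : ‖1 - d * σ d‖ = ‖ϖ‖ ^ (val ϖ b + val ϖ c) := by
    rw [show 1 - d * σ d = c * σ b by linear_combination -r4, norm_mul, hn,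
      norm_eq_zpow_val hϖ hϖE hb, norm_eq_zpow_val hϖ hϖE hc, mul_comm, zpow_add₀ h0]
  -- Both `e²` and `z σ(z)` have even valuation, so the single factor `ϖ` decides the parity.
  have hodd : Odd (val ϖ b + val ϖ c) := by
    have h3 := congrArg norm hgram
    rw [norm_mul, norm_mul, norm_mul, norm_neg, norm_pow, hn, norm_algebraMap', norm_algebraMap',
      hbc, hϖ.norm_eq_zpow_val he, norm_eq_zpow_val hϖ hϖE hz, ← zpow_natCast, ← zpow_mul,
      ← zpow_add₀ h0, ← zpow_add₀ h0, ← zpow_one_add₀ h0] at h3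
    have := hϖ.zpow_inj h3
    rw [Int.odd_iff]
    push_cast at this
    omega
  -- Otherwise `d σ(d)` would dominate and `1 - d σ(d)` would have even valuation.
  have hd : ‖d‖ ≤ 1 := by
    by_contra! hd
    have hd0 : d ≠ 0 := by
      rintro rfl
      simp at hd
      linarith
    have hdd : ‖(1 : E)‖ < ‖-(d * σ d)‖ := by
      rw [norm_one, norm_neg, norm_mul, hn]
      nlinarith
    have h3 := norm_add_eq_left hdd
    rw [neg_add_eq_sub, hbc, norm_neg, norm_mul, hn, norm_eq_zpow_val hϖ hϖE hd0,
      ← zpow_add₀ h0] at h3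
    have := hϖ.zpow_inj h3
    rw [Int.odd_iff] at hodd
    omega
  have ha : ‖a‖ = ‖d‖ := by
    have h3 : a * σ b = -(b * σ d) := by linear_combination r2
    have h4 := congrArg norm h3
    rw [norm_neg, norm_mul, norm_mul, hn, hn, mul_comm] at h4
    exact mul_left_cancel₀ (norm_ne_zero_iff.mpr hb) h4
  have hpos : 0 < val ϖ b + val ϖ c := by
    have h3 : ‖1 - d * σ d‖ ≤ 1 := by
      refine ultrametric_norm_sub_le norm_one.le ?_
      rw [norm_mul, hn]
      exact mul_le_one₀ hd (norm_nonneg _) hd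
    rw [hbc, ← zpow_zero ‖ϖ‖, hϖ.zpow_le_zpow_iff] at h3
    rw [Int.odd_iff] at hodd
    omega
  have hσc : σ c ≠ 0 := by simpa using hc
  obtain ⟨A, hA⟩ := exists_algebraMap_eq_of_fixed h2 hσ (x := (d - a) / c) (by
    rw [map_div₀, map_sub, div_eq_div_iff hσc hc]
    linear_combination r3' - r3)
  obtain ⟨B, hB⟩ := exists_algebraMap_eq_of_fixed h2 hσ (x := b / c) (by
    rw [map_div₀, div_eq_div_iff hσc hc]
    linear_combination r4 - r4')
  exact ⟨hb, hc, he, ha.trans_le hd, hd, hodd, hpos, A, B, by rw [hA, div_mul_cancel₀ _ hc],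
    by rw [hB, div_mul_cancel₀ _ hc]⟩

/-- A quadratic polynomial with a dominant linear coefficient splits. -/
theorem exists_roots_of_norm_lt {F : Type*} [NormedField F] [CompleteSpace F] [IsUltrametricDist F]
    {A B : F} (h : ‖B‖ < ‖A‖ ^ 2) :
    ∃ s₁ s₂ : F, s₁ + s₂ = A ∧ s₁ * s₂ = -B ∧ ‖s₁‖ = ‖A‖ ∧ ‖s₂‖ * ‖A‖ = ‖B‖ := by
  have hA : A ≠ 0 := by
    rintro rfl
    simp only [norm_zero, ne_eq, OfNat.ofNat_ne_zero, not_false_eq_true, zero_pow] at h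
    exact absurd h (norm_nonneg _).not_gt
  set t : F := -B / A ^ 2 with ht
  have ht1 : ‖t‖ < 1 := by
    rw [ht, norm_div, norm_neg, norm_pow]
    exact (div_lt_one (pow_pos (norm_pos_iff.mpr hA) 2)).mpr h
  -- With `t = -B/A²`, the substitution `X = A u` turns `X² - A X - B = 0` into `u = t + u²`. The
  -- right-hand side contracts the ball of radius `‖t‖`, as `u² - u'² = (u + u')(u - u')`. No
  -- division by `2` is needed.
  obtain ⟨u, hu1, hu⟩ : ∃ u : F, ‖u‖ ≤ ‖t‖ ∧ t + u ^ 2 = u := by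
    have hmaps : Set.MapsTo (fun u : F => t + u ^ 2) (Metric.closedBall 0 ‖t‖)
        (Metric.closedBall 0 ‖t‖) := by
      intro u hu
      rw [mem_closedBall_zero_iff] at hu ⊢
      refine ultrametric_norm_add_le le_rfl ?_
      rw [norm_pow, sq]
      exact (mul_le_of_le_one_right (norm_nonneg _) (hu.trans ht1.le)).trans hu
    have hc : ContractingWith ‖t‖₊ (hmaps.restrict _ _ _) := by
      refine ⟨by exact_mod_cast ht1, LipschitzWith.of_dist_le_mul ?_⟩
      rintro ⟨x, hx⟩ ⟨y, hy⟩
      rw [mem_closedBall_zero_iff] at hx hy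
      change dist (t + x ^ 2) (t + y ^ 2) ≤ ‖t‖ * dist x y
      rw [dist_eq_norm, dist_eq_norm, add_sub_add_left_eq_sub, sq_sub_sq, norm_mul]
      exact mul_le_mul_of_nonneg_right (ultrametric_norm_add_le hx hy) (norm_nonneg _)
    obtain ⟨u, hu, hfix, -⟩ := hc.exists_fixedPoint' Metric.isClosed_closedBall.isComplete hmaps
      (x := 0) (by simp) (edist_ne_top _ _)
    exact ⟨u, mem_closedBall_zero_iff.mp hu, hfix⟩
  have h1u : ‖1 - u‖ = 1 := by
    rw [sub_eq_add_neg, norm_add_eq_left, norm_one]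
    rw [norm_neg, norm_one]
    exact hu1.trans_lt ht1
  have hut : u * (1 - u) = t := by linear_combination -hu
  have hs : A * (1 - u) * (A * u) = -B := by
    have : A ^ 2 * t = -B := by rw [ht]; field_simp
    linear_combination A ^ 2 * hut + this
  have hn : ‖A * (1 - u)‖ = ‖A‖ := by rw [norm_mul, h1u, mul_one]
  refine ⟨A * (1 - u), A * u, by ring, hs, hn, ?_⟩
  have := congrArg norm hs
  rw [norm_mul, hn, norm_neg] at this
  rw [mul_comm, this]

/-- The set of `y ∈ O_F` cut out by the integrality conditions on `hγh⁻¹`, where `h` is upper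
triangular with off-diagonal entry `y`. -/
def quadraticSet {F : Type*} [NormedField F] (ϖ A B : F) (n l : ℤ) : Set F :=
  {y | ‖y‖ ≤ 1 ∧ ‖y‖ ≤ ‖ϖ‖ ^ l ∧ ‖B + A * y - y ^ 2‖ ≤ ‖ϖ‖ ^ (l + n)}

/-! ### The quadratic condition on the off-diagonal entry -/

section QuadraticSet

variable {F : Type*} [NormedField F]

theorem norm_le_zpow_of_forall {ϖ : F} (hϖ : IsUniformizer ϖ) {y : F} {m : ℤ}
    (h : ∀ k : ℤ, ‖y‖ = ‖ϖ‖ ^ k → m ≤ k) : ‖y‖ ≤ ‖ϖ‖ ^ m := by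
  rcases eq_or_ne y 0 with rfl | hy
  · rw [norm_zero]
    exact (hϖ.zpow_pos m).le
  · obtain ⟨k, hk⟩ := hϖ.exists_norm_eq_zpow hy
    rw [hk, hϖ.zpow_le_zpow_iff]
    exact h k hk

theorem norm_le_one_iff_zpow (ϖ y : F) : ‖y‖ ≤ 1 ↔ ‖y‖ ≤ ‖ϖ‖ ^ (0 : ℤ) := by
  rw [zpow_zero]

theorem norm_mul_le_zpow {ϖ : F} (hϖ : IsUniformizer ϖ) {x y : F} {m n k : ℤ}
    (hx : ‖x‖ ≤ ‖ϖ‖ ^ m) (hy : ‖y‖ ≤ ‖ϖ‖ ^ n) (hk : k ≤ m + n) : ‖x * y‖ ≤ ‖ϖ‖ ^ k := by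
  rw [norm_mul]
  refine (mul_le_mul hx hy (norm_nonneg _) (hϖ.zpow_pos m).le).trans ?_
  rw [← zpow_add₀ hϖ.norm_pos.ne', hϖ.zpow_le_zpow_iff]
  exact hk

theorem IsUniformizer.zpow_le {ϖ : F} (hϖ : IsUniformizer ϖ) {y : F} {m n : ℤ}
    (h : ‖y‖ ≤ ‖ϖ‖ ^ m) (hn : n ≤ m) : ‖y‖ ≤ ‖ϖ‖ ^ n :=
  h.trans (hϖ.zpow_le_zpow_iff.mpr hn)

theorem IsUniformizer.le_of_zpow_le {ϖ : F} (hϖ : IsUniformizer ϖ) {y : F} {m n : ℤ}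
    (h : ‖y‖ ≤ ‖ϖ‖ ^ n) (hy : ‖y‖ = ‖ϖ‖ ^ m) : n ≤ m := by
  rwa [hy, hϖ.zpow_le_zpow_iff] at h

theorem mem_quadraticSet_iff_of_roots {ϖ y₁ y₂ y : F} {n l : ℤ} :
    y ∈ quadraticSet ϖ (y₁ + y₂) (-(y₁ * y₂)) n l ↔
      ‖y‖ ≤ 1 ∧ ‖y‖ ≤ ‖ϖ‖ ^ l ∧ ‖(y - y₁) * (y - y₂)‖ ≤ ‖ϖ‖ ^ (l + n) := by
  rw [← norm_neg ((y - y₁) * (y - y₂)),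
    show -((y - y₁) * (y - y₂)) = -(y₁ * y₂) + (y₁ + y₂) * y - y ^ 2 by ring]
  exact Iff.rfl

variable [IsUltrametricDist F]

theorem norm_sub_eq_right {x y : F} (h : ‖x‖ < ‖y‖) : ‖x - y‖ = ‖y‖ := by
  rw [norm_sub_rev, sub_eq_add_neg, norm_add_eq_left (by rwa [norm_neg])]

theorem norm_sub_eq_left {x y : F} (h : ‖y‖ < ‖x‖) : ‖x - y‖ = ‖x‖ := by
  rw [norm_sub_rev, norm_sub_eq_right h]

/-- For `y` outside the ball, `y²` strictly dominates both other terms, so the condition reads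
`2v(y) ≥ l + n = 2n - i` and fails. The truncated subtraction `n - i / 2` absorbs the requirement
that `y` be integral. -/
theorem quadraticSet_eq_of_small_linear {ϖ : F} (hϖ : IsUniformizer ϖ) {A B : F} {n i M : ℕ}
    {l : ℤ} (hl : l = n - i) (hB : ‖B‖ = ‖ϖ‖ ^ (2 * M + 1 + 2 * l))
    (hA : ‖A‖ ≤ ‖ϖ‖ ^ (M + 1 + l)) (hi : i ≤ 2 * M + 1) :
    quadraticSet ϖ A B n l = {y | ‖y - 0‖ ≤ ‖ϖ‖ ^ ((n - i / 2 : ℕ) : ℤ)} := by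
  ext y
  simp only [sub_zero]
  constructor
  · rintro ⟨h1, -, h3⟩
    refine norm_le_zpow_of_forall hϖ fun k hk => ?_
    rw [norm_le_one_iff_zpow ϖ] at h1
    have h0 := hϖ.le_of_zpow_le h1 hk
    by_contra! hlt
    have hy2 : ‖y ^ 2‖ = ‖ϖ‖ ^ (2 * k) := by
      rw [norm_pow, hk, ← zpow_natCast, ← zpow_mul]
      ring_nf
    have hAy : ‖B + A * y‖ ≤ ‖ϖ‖ ^ (2 * k + 1) := by
      refine ultrametric_norm_add_le (hϖ.zpow_le hB.le (by omega)) ?_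
      exact norm_mul_le_zpow hϖ hA hk.le (by omega)
    rw [norm_sub_eq_right, hy2, hϖ.zpow_le_zpow_iff] at h3
    · omega
    · rw [hy2]
      exact hAy.trans_lt (hϖ.zpow_lt_zpow_iff.mpr (by omega))
  · intro h
    refine ⟨?_, hϖ.zpow_le h (by omega), ultrametric_norm_sub_le (ultrametric_norm_add_le ?_ ?_) ?_⟩
    · rw [norm_le_one_iff_zpow ϖ]
      exact hϖ.zpow_le h (by omega)
    · exact hϖ.zpow_le hB.le (by omega)
    · exact norm_mul_le_zpow hϖ hA h (by omega)
    · rw [sq]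
      exact norm_mul_le_zpow hϖ h h (by omega)

/-- `B` has odd and `y²` even valuation, so they never cancel. For `v(y) ≥ M + 1 + l` the term `B`
dominates, otherwise `y²` does; in either case the valuation stays below `l + n = 2l + i`. -/
theorem quadraticSet_eq_empty_of_small_linear {ϖ : F} (hϖ : IsUniformizer ϖ) {A B : F}
    {n i M : ℕ} {l : ℤ} (hl : l = n - i) (hB : ‖B‖ = ‖ϖ‖ ^ (2 * M + 1 + 2 * l))
    (hA : ‖A‖ ≤ ‖ϖ‖ ^ (M + 1 + l)) (hi : 2 * M + 1 < i) :
    quadraticSet ϖ A B n l = ∅ := by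
  refine Set.eq_empty_of_forall_notMem ?_
  rintro y ⟨-, -, h3⟩
  by_cases hy : ‖y‖ ≤ ‖ϖ‖ ^ (M + 1 + l)
  · rw [add_sub_assoc, norm_add_eq_left, hB, hϖ.zpow_le_zpow_iff] at h3
    · omega
    · rw [hB]
      refine lt_of_le_of_lt (ultrametric_norm_sub_le (c := ‖ϖ‖ ^ (2 * M + 2 + 2 * l)) ?_ ?_)
        (hϖ.zpow_lt_zpow_iff.mpr (by omega))
      · exact norm_mul_le_zpow hϖ hA hy (by omega)
      · rw [sq]
        exact norm_mul_le_zpow hϖ hy hy (by omega)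
  · apply hy
    refine norm_le_zpow_of_forall hϖ fun k hk => ?_
    by_contra! hlt
    have hy2 : ‖y ^ 2‖ = ‖ϖ‖ ^ (2 * k) := by
      rw [norm_pow, hk, ← zpow_natCast, ← zpow_mul]
      ring_nf
    have hAy : ‖B + A * y‖ ≤ ‖ϖ‖ ^ (2 * k + 1) := by
      refine ultrametric_norm_add_le (hϖ.zpow_le hB.le (by omega)) ?_
      exact norm_mul_le_zpow hϖ hA hk.le (by omega)
    rw [norm_sub_eq_right, hy2, hϖ.zpow_le_zpow_iff] at h3
    · omega
    · rw [hy2]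
      exact hAy.trans_lt (hϖ.zpow_lt_zpow_iff.mpr (by omega))

/-- While `i ≤ 2D`, both roots are too close to `0` to be distinguished from it: outside the ball,
`y - y₁` and `y - y₂` have the norm of `y`. -/
theorem quadraticSet_eq_of_split_of_le {ϖ : F} (hϖ : IsUniformizer ϖ) {y₁ y₂ : F} {n i D G : ℕ}
    {l : ℤ} (hl : l = n - i) (hDG : D < G) (h₁ : ‖y₁‖ = ‖ϖ‖ ^ (D + l))
    (h₂ : ‖y₂‖ = ‖ϖ‖ ^ (G + l)) (hi : i ≤ 2 * D) :
    quadraticSet ϖ (y₁ + y₂) (-(y₁ * y₂)) n l = {y | ‖y - 0‖ ≤ ‖ϖ‖ ^ ((n - i / 2 : ℕ) : ℤ)} := by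
  ext y
  rw [mem_quadraticSet_iff_of_roots]
  simp only [sub_zero]
  constructor
  · rintro ⟨h1, -, h3⟩
    refine norm_le_zpow_of_forall hϖ fun k hk => ?_
    rw [norm_le_one_iff_zpow ϖ] at h1
    have h0 := hϖ.le_of_zpow_le h1 hk
    by_contra! hlt
    have e1 : ‖y - y₁‖ = ‖ϖ‖ ^ k := by
      rw [norm_sub_eq_left, hk]
      rw [h₁, hk, hϖ.zpow_lt_zpow_iff]
      omega
    have e2 : ‖y - y₂‖ = ‖ϖ‖ ^ k := by
      rw [norm_sub_eq_left, hk]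
      rw [h₂, hk, hϖ.zpow_lt_zpow_iff]
      omega
    rw [norm_mul, e1, e2, ← zpow_add₀ hϖ.norm_pos.ne', hϖ.zpow_le_zpow_iff] at h3
    omega
  · intro h
    refine ⟨?_, hϖ.zpow_le h (by omega), ?_⟩
    · rw [norm_le_one_iff_zpow ϖ]
      exact hϖ.zpow_le h (by omega)
    · refine norm_mul_le_zpow hϖ (m := min ((n - i / 2 : ℕ) : ℤ) (D + l))
        (n := min ((n - i / 2 : ℕ) : ℤ) (D + l)) ?_ ?_ (by omega)
      · exact ultrametric_norm_sub_le (hϖ.zpow_le h (by omega)) (hϖ.zpow_le h₁.le (by omega))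
      · exact ultrametric_norm_sub_le (hϖ.zpow_le h (by omega)) (hϖ.zpow_le h₂.le (by omega))

/-- The roots are at distance `‖ϖ‖^(D + l)`. A point too far from `y₁` must be nearer to `y₂` than
this, so its distance to `y₁` is exactly that and `y - y₂` has to supply the remaining valuation `n
- D`. -/
theorem quadraticSet_eq_of_split_of_lt {ϖ : F} (hϖ : IsUniformizer ϖ) {y₁ y₂ : F} {n i D G : ℕ}
    {l : ℤ} (hl : l = n - i) (hDG : D < G) (h₁ : ‖y₁‖ = ‖ϖ‖ ^ (D + l))
    (h₂ : ‖y₂‖ = ‖ϖ‖ ^ (G + l)) (hi : 2 * D < i) :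
    quadraticSet ϖ (y₁ + y₂) (-(y₁ * y₂)) n l =
      {y | ‖y‖ ≤ 1 ∧ ‖y - y₁‖ ≤ ‖ϖ‖ ^ ((n : ℤ) - D)} ∪
      {y | ‖y‖ ≤ 1 ∧ ‖y - y₂‖ ≤ ‖ϖ‖ ^ ((n : ℤ) - D)} := by
  have h12 : ‖y₁ - y₂‖ = ‖ϖ‖ ^ (D + l) := by
    rw [norm_sub_eq_left, h₁]
    rw [h₁, h₂, hϖ.zpow_lt_zpow_iff]
    omega
  have hlt : ‖ϖ‖ ^ ((n : ℤ) - D) < ‖ϖ‖ ^ (D + l) := hϖ.zpow_lt_zpow_iff.mpr (by omega)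
  ext y
  rw [mem_quadraticSet_iff_of_roots]
  constructor
  · rintro ⟨h1, -, h3⟩
    by_cases hy : ‖y - y₁‖ ≤ ‖ϖ‖ ^ ((n : ℤ) - D)
    · exact Or.inl ⟨h1, hy⟩
    refine Or.inr ⟨h1, norm_le_zpow_of_forall hϖ fun k hk => ?_⟩
    have hy1 : y - y₁ ≠ 0 := by
      intro h0
      rw [h0, norm_zero] at hy
      exact hy (hϖ.zpow_pos _).le
    obtain ⟨j, hj⟩ := hϖ.exists_norm_eq_zpow hy1
    rw [hj, hϖ.zpow_le_zpow_iff] at hy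
    rw [norm_mul, hj, hk, ← zpow_add₀ hϖ.norm_pos.ne', hϖ.zpow_le_zpow_iff] at h3
    have hj' : ‖y - y₁‖ = ‖ϖ‖ ^ (D + l) := by
      rw [← h12, show y₁ - y₂ = (y - y₂) - (y - y₁) by ring, norm_sub_eq_right (x := y - y₂)]
      rw [hj, hk, hϖ.zpow_lt_zpow_iff]
      by_contra! hle
      have h4 : ‖y₁ - y₂‖ ≤ ‖ϖ‖ ^ k := by
        rw [show y₁ - y₂ = (y - y₂) - (y - y₁) by ring]
        exact ultrametric_norm_sub_le hk.le (hϖ.zpow_le hj.le hle)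
      rw [h12, hϖ.zpow_le_zpow_iff] at h4
      omega
    rw [hj] at hj'
    have := hϖ.zpow_inj hj'
    omega
  · rintro (⟨h1, hy⟩ | ⟨h1, hy⟩)
    · have hy2 : ‖y - y₂‖ = ‖ϖ‖ ^ (D + l) := by
        rw [← sub_add_sub_cancel y y₁ y₂, add_comm, norm_add_eq_left, h12]
        rw [h12]
        exact hy.trans_lt hlt
      refine ⟨h1, ?_, norm_mul_le_zpow hϖ hy hy2.le (by omega)⟩
      rw [← sub_add_cancel y y₁]
      exact ultrametric_norm_add_le (hϖ.zpow_le hy (by omega)) (hϖ.zpow_le h₁.le (by omega))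
    · have hy1 : ‖y - y₁‖ = ‖ϖ‖ ^ (D + l) := by
        rw [← sub_sub_sub_cancel_right y y₁ y₂, norm_sub_eq_right, h12]
        rw [h12]
        exact hy.trans_lt hlt
      refine ⟨h1, ?_, norm_mul_le_zpow hϖ hy1.le hy (by omega)⟩
      rw [← sub_add_cancel y y₂]
      exact ultrametric_norm_add_le (hϖ.zpow_le hy (by omega)) (hϖ.zpow_le h₂.le (by omega))

theorem ball_inter_eq_of_norm_le_one {ϖ : F} (hϖ : IsUniformizer ϖ) {y₀ : F} {k : ℤ} (hk : 0 ≤ k)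
    (h : ‖y₀‖ ≤ 1) : {y | ‖y‖ ≤ 1 ∧ ‖y - y₀‖ ≤ ‖ϖ‖ ^ k} = {y | ‖y - y₀‖ ≤ ‖ϖ‖ ^ k} := by
  ext y
  refine ⟨fun h => h.2, fun hy => ⟨?_, hy⟩⟩
  rw [← sub_add_cancel y y₀]
  refine ultrametric_norm_add_le ?_ h
  rw [norm_le_one_iff_zpow ϖ]
  exact hϖ.zpow_le hy hk

theorem ball_inter_eq_of_nonpos {ϖ : F} (hϖ : IsUniformizer ϖ) {y₀ : F} {k : ℤ} (hk : k ≤ 0)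
    (h : ‖y₀‖ ≤ ‖ϖ‖ ^ k) : {y | ‖y‖ ≤ 1 ∧ ‖y - y₀‖ ≤ ‖ϖ‖ ^ k} =
      {y | ‖y - 0‖ ≤ ‖ϖ‖ ^ (0 : ℤ)} := by
  ext y
  simp only [sub_zero, zpow_zero]
  refine ⟨fun h => h.1, fun hy => ⟨hy, ultrametric_norm_sub_le ?_ h⟩⟩
  exact (hϖ.zpow_le ((norm_le_one_iff_zpow ϖ y).mp hy) hk)

theorem ball_inter_eq_empty {ϖ y₀ : F} {k : ℤ} (h1 : 1 < ‖y₀‖) (h2 : ‖ϖ‖ ^ k < ‖y₀‖) :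
    {y | ‖y‖ ≤ 1 ∧ ‖y - y₀‖ ≤ ‖ϖ‖ ^ k} = ∅ := by
  refine Set.eq_empty_of_forall_notMem ?_
  rintro y ⟨h3, h4⟩
  rw [norm_sub_eq_right (h3.trans_lt h1)] at h4
  exact absurd h4 h2.not_ge

end QuadraticSet

/-- The number of classes modulo `ϖ ^ n` in `quadraticSet` when the linear term is negligible. -/
def nonsplitCount (q M n i : ℕ) : ℕ :=
  if i ≤ 2 * M + 1 then q ^ min n (i / 2) else 0

/-- The number of classes modulo `ϖ ^ n` in `quadraticSet` when the linear term dominates. -/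
def splitCount (q D G n i : ℕ) : ℕ :=
  if i ≤ 2 * D then q ^ min n (i / 2)
  else (if i ≤ n + D then q ^ D else 0) + (if i ≤ G + max n D then q ^ min n D else 0)

/-! ### Counting classes in the quadratic set -/

section Count

variable (p : ℕ) [Fact p.Prime] {F : Type*} [NormedField F] [NormedAlgebra ℚ_[p] F]
  [FiniteDimensional ℚ_[p] F]

theorem exists_isTransversal_ball_of_add_eq {ϖ : F} (hϖ : IsUniformizer ϖ) (y₀ : F) {k n : ℤ}
    {j : ℕ} (h : k + j = n) :
    ∃ Y, IsTransversal ϖ n {y | ‖y - y₀‖ ≤ ‖ϖ‖ ^ k} Y ∧ Y.card = residueCard p F ^ j :=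
  h ▸ exists_isTransversal_ball p hϖ y₀ k j

theorem exists_isTransversal_nonsplit {ϖ : F} (hϖ : IsUniformizer ϖ) {A B : F} {n i M : ℕ} {l : ℤ}
    (hl : l = n - i) (hB : ‖B‖ = ‖ϖ‖ ^ (2 * M + 1 + 2 * l)) (hA : ‖A‖ ≤ ‖ϖ‖ ^ (M + 1 + l)) :
    ∃ Y, IsTransversal ϖ n (quadraticSet ϖ A B n l) Y ∧
      Y.card = nonsplitCount (residueCard p F) M n i := by
  have hu := isUltrametricDist_of_padic p F
  rw [nonsplitCount]
  split_ifs with hi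
  · rw [quadraticSet_eq_of_small_linear hϖ hl hB hA hi]
    exact exists_isTransversal_ball_of_add_eq p hϖ 0 (by omega)
  · rw [quadraticSet_eq_empty_of_small_linear hϖ hl hB hA (by omega)]
    exact ⟨∅, isTransversal_empty ϖ n, rfl⟩

theorem exists_isTransversal_split {ϖ : F} (hϖ : IsUniformizer ϖ) {y₁ y₂ : F} {n i D G : ℕ} {l : ℤ}
    (hl : l = n - i) (hDG : D < G) (h₁ : ‖y₁‖ = ‖ϖ‖ ^ (D + l)) (h₂ : ‖y₂‖ = ‖ϖ‖ ^ (G + l)) :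
    ∃ Y, IsTransversal ϖ n (quadraticSet ϖ (y₁ + y₂) (-(y₁ * y₂)) n l) Y ∧
      Y.card = splitCount (residueCard p F) D G n i := by
  have hu := isUltrametricDist_of_padic p F
  have hone : ∀ k : ℤ, 1 < ‖ϖ‖ ^ k ↔ k < 0 := by
    intro k
    rw [← zpow_zero ‖ϖ‖, hϖ.zpow_lt_zpow_iff]
  rw [splitCount]
  split_ifs with hi hi1 hi2 hi2
  · rw [quadraticSet_eq_of_split_of_le hϖ hl hDG h₁ h₂ hi]
    exact exists_isTransversal_ball_of_add_eq p hϖ 0 (by omega)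
  all_goals
    rw [quadraticSet_eq_of_split_of_lt hϖ hl hDG h₁ h₂ (by omega)]
    refine exists_isTransversal_union ?_ ?_ ?_
    -- The two balls remain separated modulo `ϖ^n`, because `i > 2D` means `n - D > D + l = v(y₁ -
    -- y₂)`.
    · rintro x ⟨-, hx⟩ y ⟨-, hy⟩
      have h12 : ‖y₁ - y₂‖ = ‖ϖ‖ ^ (D + l) := by
        rw [norm_sub_eq_left, h₁]
        rw [h₁, h₂, hϖ.zpow_lt_zpow_iff]
        omega
      by_contra! hlt
      have h4 : ‖y₁ - y₂‖ ≤ ‖ϖ‖ ^ ((n : ℤ) - D) := by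
        rw [show y₁ - y₂ = (y - y₂) + ((x - y) - (x - y₁)) by ring]
        exact ultrametric_norm_add_le hy (ultrametric_norm_sub_le (hϖ.zpow_le hlt (by omega)) hx)
      rw [h12, hϖ.zpow_le_zpow_iff] at h4
      omega
  · rw [ball_inter_eq_of_norm_le_one hϖ (by omega) (by
      rw [norm_le_one_iff_zpow ϖ]; exact hϖ.zpow_le h₁.le (by omega))]
    exact exists_isTransversal_ball_of_add_eq p hϖ _ (by omega)
  · rw [min_eq_right (by omega), ball_inter_eq_of_norm_le_one hϖ (by omega) (by
      rw [norm_le_one_iff_zpow ϖ]; exact hϖ.zpow_le h₂.le (by omega))]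
    exact exists_isTransversal_ball_of_add_eq p hϖ _ (by omega)
  · rw [ball_inter_eq_of_norm_le_one hϖ (by omega) (by
      rw [norm_le_one_iff_zpow ϖ]; exact hϖ.zpow_le h₁.le (by omega))]
    exact exists_isTransversal_ball_of_add_eq p hϖ _ (by omega)
  · rw [ball_inter_eq_empty (by rw [h₂, hone]; omega)
      (by rw [h₂, hϖ.zpow_lt_zpow_iff]; omega)]
    exact ⟨∅, isTransversal_empty ϖ n, rfl⟩
  · rw [ball_inter_eq_empty (by rw [h₁, hone]; omega)
      (by rw [h₁, hϖ.zpow_lt_zpow_iff]; omega)]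
    exact ⟨∅, isTransversal_empty ϖ n, rfl⟩
  -- If `n < D`, the ball around `y₂` has radius greater than one. As it meets `O_F`, it contains
  -- all of `O_F`, which has `q^n` classes rather than `q^D`.
  · rcases le_or_gt D n with hDn | hDn
    · rw [min_eq_right (by omega), ball_inter_eq_of_norm_le_one hϖ (by omega) (by
        rw [norm_le_one_iff_zpow ϖ]; exact hϖ.zpow_le h₂.le (by omega))]
      exact exists_isTransversal_ball_of_add_eq p hϖ _ (by omega)
    · rw [min_eq_left (by omega), ball_inter_eq_of_nonpos hϖ (by omega)
        (hϖ.zpow_le h₂.le (by omega))]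
      exact exists_isTransversal_ball_of_add_eq p hϖ _ (by omega)
  · rw [ball_inter_eq_empty (by rw [h₁, hone]; omega)
      (by rw [h₁, hϖ.zpow_lt_zpow_iff]; omega)]
    exact ⟨∅, isTransversal_empty ϖ n, rfl⟩
  · rw [ball_inter_eq_empty (by rw [h₂, hone]; omega)
      (by rw [h₂, hϖ.zpow_lt_zpow_iff]; omega)]
    exact ⟨∅, isTransversal_empty ϖ n, rfl⟩

end Count

/-! ### Evaluation of the alternating sums -/

theorem sum_range_ite_le {J k : ℕ} (h : k < J) (g : ℕ → ℂ) :
    ∑ t ∈ Finset.range J, (if t ≤ k then g t else 0) = ∑ t ∈ Finset.range (k + 1), g t := by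
  rw [← Finset.sum_filter]
  congr 1
  ext t
  simp only [Finset.mem_filter, Finset.mem_range]
  omega

theorem sum_range_alternating (K : ℂ) (k : ℕ) :
    ∑ t ∈ Finset.range (k + 1), (-1) ^ t * (K - t) =
      ((-1) ^ k * (2 * K - 2 * k - 1) + (2 * K + 1)) / 4 := by
  induction k with
  | zero => simp; ring
  | succ k ih => rw [Finset.sum_range_succ, ih]; push_cast; ring

/-- The indices `2j` and `2j + 1` carry the same power of `q`, and their weights combine to `(K -
2j) - (K - 2j - 1) = 1`. Hence `K` disappears. -/
theorem sum_range_two_mul_alternating (K q : ℂ) (n m : ℕ) :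
    ∑ i ∈ Finset.range (2 * m), (-1) ^ i * (K - i) * q ^ min n (i / 2) =
      ∑ j ∈ Finset.range m, q ^ min n j := by
  induction m with
  | zero => simp
  | succ m ih =>
    rw [show 2 * (m + 1) = 2 * m + 1 + 1 by ring, Finset.sum_range_succ, Finset.sum_range_succ, ih,
      Finset.sum_range_succ, show 2 * m / 2 = m by omega, show (2 * m + 1) / 2 = m by omega,
      pow_succ, pow_mul]
    push_cast
    ring

/-- The extra length `t` of the range only adds zeros; it permits a common range of `i` for all `n`.
-/
theorem sum_nonsplitCount (K : ℂ) (q M n t : ℕ) :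
    ∑ i ∈ Finset.range (2 * (M + 1) + t), (-1) ^ i * (K - i) * (nonsplitCount q M n i : ℂ) =
      ∑ j ∈ Finset.range (M + 1), (q : ℂ) ^ min n j := by
  rw [Finset.sum_range_add, ← sum_range_two_mul_alternating K, Finset.sum_eq_zero (s := .range t),
    add_zero]
  · refine Finset.sum_congr rfl fun i hi => ?_
    rw [Finset.mem_range] at hi
    rw [nonsplitCount, if_pos (by omega)]
    push_cast
    rfl
  · intro i _
    rw [nonsplitCount, if_neg (by omega)]
    simp

/-- For `n < D` and `i > 2D` the ball around `y₁` misses `O_F`, and the one around `y₂` contributes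
all `q^n` classes precisely up to `i = G + D = 2M + 1`. -/
theorem splitCount_eq_nonsplitCount {q D G M n : ℕ} (hM : D + G = 2 * M + 1) (hDG : D < G)
    (hn : n < D) (i : ℕ) : splitCount q D G n i = nonsplitCount q M n i := by
  rw [splitCount, nonsplitCount]
  split_ifs <;> first | omega | skip
  rw [zero_add, min_eq_left hn.le, min_eq_left (by omega)]

/-- The part `i < 2D` telescopes as before. Beyond it, the contributions of the two roots stop at
indices differing by the odd number `G - D`. Their alternating sums therefore end with opposite
signs, `K` cancels, and half the gap survives with sign `(-1)^(n - D)`. -/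
theorem sum_splitCount (K : ℂ) {q D G M n t : ℕ} (hM : D + G = 2 * M + 1) (hDG : D < G)
    (hn : D ≤ n) (ht : n ≤ t) :
    ∑ i ∈ Finset.range (2 * (M + 1) + t), (-1) ^ i * (K - i) * (splitCount q D G n i : ℂ) =
      ∑ j ∈ Finset.range D, (q : ℂ) ^ j +
        (q : ℂ) ^ D * ((1 + (-1) ^ (n - D) * ((G : ℂ) - D)) / 2) := by
  obtain ⟨k, rfl⟩ := Nat.exists_eq_add_of_le hn
  obtain ⟨g, rfl⟩ := Nat.exists_eq_add_of_lt hDG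
  have hg : Even g := by
    rw [Nat.even_iff]; omega
  rw [show 2 * (M + 1) + t = 2 * D + (g + 2 + t) by omega, Finset.sum_range_add]
  congr 1
  · trans ∑ j ∈ Finset.range D, (q : ℂ) ^ min (D + k) j
    · rw [← sum_range_two_mul_alternating K]
      refine Finset.sum_congr rfl fun i hi => ?_
      rw [Finset.mem_range] at hi
      rw [splitCount, if_pos (by omega)]
      push_cast
      rfl
    · refine Finset.sum_congr rfl fun j hj => ?_
      rw [Finset.mem_range] at hj
      rw [min_eq_right (by omega)]
  -- With `s = i - 2D`, each root contributes `q^D` on its own range. The subtracted term at `s = 0`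
  -- corrects the double count, since at `i = 2D` there is still a single ball.
  · have hterm : ∀ s : ℕ, (-1 : ℂ) ^ (2 * D + s) * (K - (2 * D + s : ℕ)) *
        (splitCount q D (D + g + 1) (D + k) (2 * D + s) : ℂ) =
        (q : ℂ) ^ D * ((if s ≤ k then (-1) ^ s * (K - 2 * D - s) else 0) +
          (if s ≤ k + (g + 1) then (-1) ^ s * (K - 2 * D - s) else 0) -
          (if s ≤ 0 then (-1) ^ s * (K - 2 * D - s) else 0)) := by
      intro s
      have hsgn : (-1 : ℂ) ^ (2 * D + s) = (-1) ^ s := by rw [pow_add, pow_mul]; simp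
      rw [hsgn, splitCount, min_eq_right (show D ≤ D + k by omega)]
      rcases Nat.eq_zero_or_pos s with rfl | hs
      · rw [if_pos (by omega), if_pos (by omega), if_pos (by omega), if_pos (by omega),
          min_eq_right (by omega), show (2 * D + 0) / 2 = D by omega]
        push_cast
        ring
      · rw [if_neg (by omega), if_neg (show ¬ s ≤ 0 by omega)]
        have e1 : 2 * D + s ≤ D + k + D ↔ s ≤ k := by omega
        have e2 : 2 * D + s ≤ D + g + 1 + max (D + k) D ↔ s ≤ k + (g + 1) := by omega
        simp only [e1, e2]
        split_ifs <;> push_cast <;> ring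
    simp only [hterm]
    rw [← Finset.mul_sum, Finset.sum_sub_distrib, Finset.sum_add_distrib,
      sum_range_ite_le (by omega), sum_range_ite_le (by omega), sum_range_ite_le (by omega),
      sum_range_alternating, sum_range_alternating, sum_range_alternating, pow_add _ k, pow_succ,
      hg.neg_one_pow, Nat.add_sub_cancel_left]
    push_cast
    ring

theorem sum_range_pow_min {q : ℂ} {n m : ℕ} (h : n ≤ m) :
    ∑ j ∈ Finset.range m, q ^ min n j = ∑ j ∈ Finset.range n, q ^ j + ((m : ℂ) - n) * q ^ n := by
  obtain ⟨k, rfl⟩ := Nat.exists_eq_add_of_le h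
  rw [Finset.sum_range_add]
  congr 1
  · refine Finset.sum_congr rfl fun j hj => ?_
    rw [min_eq_right (Finset.mem_range.mp hj).le]
  · simp

theorem sum_sum_pow_min_of_le (q : ℂ) {N M : ℕ} (h : N ≤ M + 1) :
    ∑ n ∈ Finset.range N, ∑ j ∈ Finset.range (M + 1), q ^ min n j =
      ∑ j ∈ Finset.range N, ((N : ℂ) + M - 2 * j) * q ^ j := by
  induction N with
  | zero => simp
  | succ N ih =>
    rw [Finset.sum_range_succ, ih (by omega), sum_range_pow_min (by omega), Finset.sum_range_succ,
      ← add_assoc, ← Finset.sum_add_distrib]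
    congr 1
    · refine Finset.sum_congr rfl fun j _ => ?_
      push_cast
      ring
    · push_cast
      ring

/-- In the rectangle `k ≤ n`, `j ≤ M`, the pairs with minimum equal to `j` form a hook with `(n - j)
+ (M - j) + 1` elements. -/
theorem sum_sum_pow_min (q : ℂ) (n M : ℕ) :
    ∑ k ∈ Finset.range (n + 1), ∑ j ∈ Finset.range (M + 1), q ^ min k j =
      ∑ j ∈ Finset.range (min n M + 1), ((n : ℂ) + M + 1 - 2 * j) * q ^ j := by
  rcases le_total n M with h | h
  · rw [sum_sum_pow_min_of_le q (by omega), min_eq_left h]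
    refine Finset.sum_congr rfl fun j _ => ?_
    push_cast
    ring
  · obtain ⟨t, rfl⟩ := Nat.exists_eq_add_of_le h
    rw [min_eq_right h, show M + t + 1 = M + 1 + t by ring, Finset.sum_range_add,
      sum_sum_pow_min_of_le q le_rfl]
    have : ∀ k ∈ Finset.range t, ∑ j ∈ Finset.range (M + 1), q ^ min (M + 1 + k) j =
        ∑ j ∈ Finset.range (M + 1), q ^ j := by
      intro k _
      refine Finset.sum_congr rfl fun j hj => ?_
      rw [min_eq_right (by have := Finset.mem_range.mp hj; omega)]
    rw [Finset.sum_congr rfl this, Finset.sum_const, Finset.card_range, nsmul_eq_mul,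
      Finset.mul_sum, ← Finset.sum_add_distrib]
    refine Finset.sum_congr rfl fun j _ => ?_
    push_cast
    ring

/-- The derivative of the orbital integral when the linear term is negligible, in closed form. -/
theorem sum_sum_nonsplitCount (κ : ℂ) (q M ε : ℕ) :
    ∑ n ∈ Finset.range (ε + 1), ∑ i ∈ Finset.range (2 * (M + 1) + ε),
      (-1) ^ i * (2 * n + κ - i) * (nonsplitCount q M n i : ℂ) =
      ∑ j ∈ Finset.range (min ε M + 1), ((ε : ℂ) + M + 1 - 2 * j) * (q : ℂ) ^ j := by
  rw [← sum_sum_pow_min]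
  exact Finset.sum_congr rfl fun n _ => sum_nonsplitCount _ _ _ _ _

theorem sum_range_half_alternating (h : ℂ) (k : ℕ) :
    ∑ s ∈ Finset.range (k + 1), (1 + (-1) ^ s * h) / 2 =
      ((k : ℂ) + 1) / 2 + h * (1 + (-1) ^ k) / 4 := by
  induction k with
  | zero => simp; ring
  | succ k ih => rw [Finset.sum_range_succ, ih, pow_succ]; push_cast; ring

/-- Rows with `n < D` do not see the splitting and are summed as in the other case; rows `n = D + s`
contribute the two-root formula, whose signs alternate in `s`. -/
theorem sum_sum_splitCount (κ : ℂ) {q D G M k : ℕ} (hM : D + G = 2 * M + 1) (hDG : D < G) :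
    ∑ n ∈ Finset.range (D + k + 1), ∑ i ∈ Finset.range (2 * (M + 1) + (D + k)),
      (-1) ^ i * (2 * n + κ - i) * (splitCount q D G n i : ℂ) =
      ∑ j ∈ Finset.range D, ((D : ℂ) + k + M + 1 - 2 * j) * (q : ℂ) ^ j +
        (((k : ℂ) + 1) / 2 + ((G : ℂ) - D) * (1 + (-1) ^ k) / 4) * (q : ℂ) ^ D := by
  have h1 : ∀ n ∈ Finset.range D, ∑ i ∈ Finset.range (2 * (M + 1) + (D + k)),
      (-1) ^ i * (2 * n + κ - i) * (splitCount q D G n i : ℂ) =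
      ∑ j ∈ Finset.range (M + 1), (q : ℂ) ^ min n j := by
    intro n hn
    simp only [splitCount_eq_nonsplitCount hM hDG (Finset.mem_range.mp hn)]
    exact sum_nonsplitCount _ _ _ _ _
  have h2 : ∀ s ∈ Finset.range (k + 1), ∑ i ∈ Finset.range (2 * (M + 1) + (D + k)),
      (-1) ^ i * (2 * ((D + s : ℕ) : ℂ) + κ - i) * (splitCount q D G (D + s) i : ℂ) =
      ∑ j ∈ Finset.range D, (q : ℂ) ^ j +
        (q : ℂ) ^ D * ((1 + (-1) ^ s * ((G : ℂ) - D)) / 2) := by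
    intro s hs
    rw [sum_splitCount _ hM hDG (by omega) (by have := Finset.mem_range.mp hs; omega),
      Nat.add_sub_cancel_left]
  rw [show D + k + 1 = D + (k + 1) by ring, Finset.sum_range_add, Finset.sum_congr rfl h1,
    Finset.sum_congr rfl h2, sum_sum_pow_min_of_le _ (by omega), Finset.sum_add_distrib,
    ← Finset.mul_sum, sum_range_half_alternating, Finset.sum_const, Finset.card_range,
    nsmul_eq_mul, Finset.mul_sum, ← add_assoc, ← Finset.sum_add_distrib]
  congr 1
  · refine Finset.sum_congr rfl fun j _ => ?_
    push_cast
    ring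
  · ring

theorem mainSum_of_neg {q : ℕ} {ve vb vc : ℤ} {r : ℕ} {N : ℤ} (hN : N < 0) :
    mainSum q ve vb vc r N = 0 := by
  rw [mainSum, Finset.Icc_eq_empty (by omega), Finset.sum_empty]

theorem mainSum_natCast (q : ℕ) (ve vb vc : ℤ) (r N : ℕ) :
    mainSum q ve vb vc r N = ∑ j ∈ Finset.range (N + 1),
      ((2 * (ve : ℂ) + vb + vc + 1) / 2 + r - 2 * j) * (q : ℂ) ^ j := by
  rw [mainSum]
  symm
  refine Finset.sum_bij (fun j _ => (j : ℤ)) ?_ ?_ ?_ ?_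
  · intro j hj
    have := Finset.mem_range.mp hj
    rw [Finset.mem_Icc]
    omega
  · intro i _ j _ h
    exact_mod_cast h
  · intro j hj
    rw [Finset.mem_Icc] at hj
    exact ⟨j.toNat, Finset.mem_range.mpr (by omega), by omega⟩
  · intro j _
    simp

/-! ### The support of the integrand -/

section OrbSupport

variable {F E : Type*} [NormedField F] [NormedField E] [NormedAlgebra F E]

/-- The condition on `h` for the integrand of the orbital integral of the characteristic function of
`symmSpaceLE` to be nonzero. -/
def OrbSupport (ϖ : F) (r : ℕ) {n : ℕ}
    (x : Matrix (Fin n) (Fin n) E × (Fin n → F) × (Fin n → F)) (h : GL (Fin n) F) : Prop :=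
  (∀ i j, ‖algebraMap F E ϖ ^ r * ((h : Matrix (Fin n) (Fin n) F).map (algebraMap F E) * x.1 *
      ((h⁻¹ : GL (Fin n) F) : Matrix (Fin n) (Fin n) F).map (algebraMap F E)) i j‖ ≤ 1) ∧
    ∀ i, ‖((h : Matrix (Fin n) (Fin n) F) *ᵥ x.2.1) i‖ ≤ 1 ∧
      ‖(x.2.2 ᵥ* ((h⁻¹ : GL (Fin n) F) : Matrix (Fin n) (Fin n) F)) i‖ ≤ 1

theorem map_GL_mul_map_inv {n : ℕ} (h : GL (Fin n) F) :
    ((h⁻¹ : GL (Fin n) F) : Matrix (Fin n) (Fin n) F).map (algebraMap F E) *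
      (h : Matrix (Fin n) (Fin n) F).map (algebraMap F E) = 1 := by
  rw [← Matrix.map_mul, ← Units.val_mul, inv_mul_cancel, Units.val_one,
    Matrix.map_one _ (map_zero _) (map_one _)]

theorem conj_mem_symmSpace {σ : E ≃ₐ[F] E} {n : ℕ} {γ : Matrix (Fin n) (Fin n) E}
    (hγ : γ ∈ symmSpace σ n) (h : GL (Fin n) F) :
    (h : Matrix (Fin n) (Fin n) F).map (algebraMap F E) * γ *
      ((h⁻¹ : GL (Fin n) F) : Matrix (Fin n) (Fin n) F).map (algebraMap F E) ∈ symmSpace σ n := by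
  have hγ' : γ * γ.map σ = 1 := hγ
  have hfix : ∀ M : Matrix (Fin n) (Fin n) F,
      (M.map (algebraMap F E)).map σ = M.map (algebraMap F E) := by
    intro M
    ext i j
    simp
  have h2 := map_GL_mul_map_inv (E := E) h⁻¹
  rw [inv_inv] at h2
  change _ * Matrix.map _ σ = 1
  rw [Matrix.map_mul, Matrix.map_mul, hfix, hfix]
  simp only [mul_assoc]
  rw [← mul_assoc (Matrix.map _ _) (Matrix.map _ _), map_GL_mul_map_inv, one_mul,
    ← mul_assoc γ, hγ', one_mul, h2]

-- Conjugation by a matrix over `F` preserves the symmetric space, so only the integrality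
-- conditions remain.
open Classical in
theorem orbIntegrand_indicator_eq (p : ℕ) [Fact p.Prime] [NormedAlgebra ℚ_[p] F] {σ : E ≃ₐ[F] E}
    (ϖ : F) (r : ℕ) {n : ℕ} {x : Matrix (Fin n) (Fin n) E × (Fin n → F) × (Fin n → F)}
    (hx : x.1 ∈ symmSpace σ n) (s : ℂ) (h : GL (Fin n) F) :
    orbIntegrand p ϖ (Set.indicator (symmSpaceLE σ ϖ n r) 1) x s h =
      if OrbSupport ϖ r x h then quadChar ϖ (h : Matrix (Fin n) (Fin n) F).det *
        (normalizedAbs p ϖ (h : Matrix (Fin n) (Fin n) F).det : ℂ) ^ (-s) else 0 := by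
  have h1 := conj_mem_symmSpace hx h
  rw [orbIntegrand, integralIndicator]
  by_cases hA : ∀ i j, ‖algebraMap F E ϖ ^ r * ((h : Matrix (Fin n) (Fin n) F).map
      (algebraMap F E) * x.1 *
      ((h⁻¹ : GL (Fin n) F) : Matrix (Fin n) (Fin n) F).map (algebraMap F E)) i j‖ ≤ 1
  · rw [Set.indicator_of_mem (show _ ∈ symmSpaceLE σ ϖ n r from ⟨h1, hA⟩)]
    by_cases hB : ∀ i, ‖((h : Matrix (Fin n) (Fin n) F) *ᵥ x.2.1) i‖ ≤ 1 ∧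
        ‖(x.2.2 ᵥ* ((h⁻¹ : GL (Fin n) F) : Matrix (Fin n) (Fin n) F)) i‖ ≤ 1
    · rw [Set.indicator_of_mem (by exact hB), if_pos ⟨hA, hB⟩]
      simp
    · rw [Set.indicator_of_notMem (by exact hB), if_neg fun h => hB h.2]
      simp
  · rw [Set.indicator_of_notMem (fun h => hA h.2), if_neg fun h => hA h.1]
    simp

theorem norm_det_eq_one [IsUltrametricDist F] {k : GL (Fin 2) F} (hk : k ∈ integralGL F 2) :
    ‖(k : Matrix (Fin 2) (Fin 2) F).det‖ = 1 := by
  have key : ∀ g : GL (Fin 2) F, g ∈ integralGL F 2 →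
      ‖(g : Matrix (Fin 2) (Fin 2) F).det‖ ≤ 1 := by
    intro g hg
    rw [Matrix.det_fin_two]
    refine ultrametric_norm_sub_le ?_ ?_ <;> rw [norm_mul]
    · exact mul_le_one₀ (hg 0 0).1 (norm_nonneg _) (hg 1 1).1
    · exact mul_le_one₀ (hg 0 1).1 (norm_nonneg _) (hg 1 0).1
  refine le_antisymm (key k hk) ?_
  have h1 := key k⁻¹ ((integralSubgroup F 2).inv_mem hk)
  have h2 : ‖(k : Matrix (Fin 2) (Fin 2) F).det‖ *
      ‖((k⁻¹ : GL (Fin 2) F) : Matrix (Fin 2) (Fin 2) F).det‖ = 1 := by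
    rw [← norm_mul, ← Matrix.det_mul, ← Units.val_mul, mul_inv_cancel, Units.val_one,
      Matrix.det_one, norm_one]
  by_contra! hlt
  have := mul_lt_one_of_nonneg_of_lt_one_left (norm_nonneg _) hlt h1
  linarith

theorem orbSupport_mul_of_mem [IsUltrametricDist F] [IsUltrametricDist E] {ϖ : F} {r n : ℕ}
    {x : Matrix (Fin n) (Fin n) E × (Fin n → F) × (Fin n → F)} {k h : GL (Fin n) F}
    (hk : k ∈ integralGL F n) (hx : OrbSupport ϖ r x h) : OrbSupport ϖ r x (k * h) := by
  obtain ⟨h1, h2⟩ := hx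
  have hk1 : ∀ i j, ‖(k : Matrix (Fin n) (Fin n) F).map (algebraMap F E) i j‖ ≤ 1 := by
    intro i j
    rw [Matrix.map_apply, norm_algebraMap']
    exact (hk i j).1
  have hk2 : ∀ i j,
      ‖((k⁻¹ : GL (Fin n) F) : Matrix (Fin n) (Fin n) F).map (algebraMap F E) i j‖ ≤ 1 := by
    intro i j
    rw [Matrix.map_apply, norm_algebraMap']
    exact (hk i j).2
  refine ⟨fun i j => ?_, fun i => ⟨?_, ?_⟩⟩
  · have h3 := matrix_mul_norm_le_one (matrix_mul_norm_le_one hk1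
      (B := algebraMap F E ϖ ^ r • ((h : Matrix (Fin n) (Fin n) F).map (algebraMap F E) * x.1 *
        ((h⁻¹ : GL (Fin n) F) : Matrix (Fin n) (Fin n) F).map (algebraMap F E)))
      (fun i j => by simpa using h1 i j)) hk2 i j
    rw [mul_inv_rev, Units.val_mul, Units.val_mul, Matrix.map_mul, Matrix.map_mul]
    rw [Matrix.mul_smul, Matrix.smul_mul, Matrix.smul_apply, smul_eq_mul] at h3
    simpa only [mul_assoc] using h3
  · rw [Units.val_mul, ← Matrix.mulVec_mulVec, Matrix.mulVec_eq_sum, Finset.sum_apply]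
    refine IsUltrametricDist.norm_sum_le_of_forall_le_of_nonneg zero_le_one fun j _ => ?_
    rw [Pi.smul_apply, op_smul_eq_mul, norm_mul, Matrix.transpose_apply]
    exact mul_le_one₀ (hk i j).1 (norm_nonneg _) (h2 j).1
  · rw [mul_inv_rev, Units.val_mul, ← Matrix.vecMul_vecMul, Matrix.vecMul_eq_sum, Finset.sum_apply]
    refine IsUltrametricDist.norm_sum_le_of_forall_le_of_nonneg zero_le_one fun j _ => ?_
    rw [Pi.smul_apply, smul_eq_mul, norm_mul]
    exact mul_le_one₀ (h2 j).2 (norm_nonneg _) (hk j i).2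

theorem orbSupport_mul_iff [IsUltrametricDist F] [IsUltrametricDist E] {ϖ : F} {r n : ℕ}
    {x : Matrix (Fin n) (Fin n) E × (Fin n → F) × (Fin n → F)} {k : GL (Fin n) F}
    (hk : k ∈ integralGL F n) (h : GL (Fin n) F) :
    OrbSupport ϖ r x (k * h) ↔ OrbSupport ϖ r x h := by
  refine ⟨fun hx => ?_, orbSupport_mul_of_mem hk⟩
  have := orbSupport_mul_of_mem ((integralSubgroup F n).inv_mem hk) hx
  rwa [inv_mul_cancel_left] at this

/-- Writing `d - a = A c` and `b = B c` makes every entry of `hγh⁻¹` equal to `c` times an element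
of `F`, up to the integral terms `a` and `d`. The latter do not affect integrality after
multiplication by `ϖ^r`, so each condition is one on norms in `F`. -/
theorem orbSupport_upperGL_iff [IsUltrametricDist E] {ϖ : Fˣ} (hϖ : IsUniformizer (ϖ : F))
    {a b c d : E} {e A B : F} {vc ve : ℤ} (hc : ‖c‖ = ‖(ϖ : F)‖ ^ vc) (he : ‖e‖ = ‖(ϖ : F)‖ ^ ve)
    (ha : ‖a‖ ≤ 1) (hd : ‖d‖ ≤ 1) (hA : algebraMap F E A * c = d - a)
    (hB : algebraMap F E B * c = b) (r : ℕ) (m n : ℤ) (y : F) :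
    OrbSupport (ϖ : F) r (!![a, b; c, d], ![0, 1], ![0, e]) (upperGL (ϖ ^ m) (ϖ ^ n) y) ↔
      0 ≤ n ∧ n ≤ ve ∧ m - r - vc ≤ n ∧
        y ∈ quadraticSet (ϖ : F) (A * ϖ ^ m) (B * ϖ ^ (2 * m)) n (m - r - vc) := by
  have h0 := hϖ.norm_pos.ne'
  have hx : algebraMap F E (ϖ : F) ^ m ≠ 0 :=
    zpow_ne_zero _ ((map_ne_zero _).mpr ϖ.ne_zero)
  have hz : algebraMap F E (ϖ : F) ^ n ≠ 0 :=
    zpow_ne_zero _ ((map_ne_zero _).mpr ϖ.ne_zero)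
  have hM : (upperGL (ϖ ^ m) (ϖ ^ n) y).val.map (algebraMap F E) * !![a, b; c, d] *
      ((upperGL (ϖ ^ m) (ϖ ^ n) y)⁻¹ : GL (Fin 2) F).val.map (algebraMap F E) =
      !![a + c * algebraMap F E (y * (ϖ : F) ^ (-m)),
        c * algebraMap F E ((B * ϖ ^ (2 * m) + A * ϖ ^ m * y - y ^ 2) * (ϖ : F) ^ (-m - n));
        c * algebraMap F E ((ϖ : F) ^ (n - m)), d - c * algebraMap F E (y * (ϖ : F) ^ (-m))] := by
    obtain rfl : d = a + algebraMap F E A * c := by rw [hA]; ring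
    subst hB
    have hϖ0 : algebraMap F E (ϖ : F) ≠ 0 := (map_ne_zero _).mpr ϖ.ne_zero
    rw [upperGL_val, upperGL_inv_val]
    simp only [zpow_sub₀ ϖ.ne_zero, zpow_neg, zpow_mul' (ϖ : F) 2 m, zpow_ofNat]
    ext i j
    fin_cases i <;> fin_cases j <;>
      simp [Matrix.mul_apply, Fin.sum_univ_two] <;> field_simp <;> ring
  have hv : ![(0 : F), e] ᵥ* ((upperGL (ϖ ^ m) (ϖ ^ n) y)⁻¹ : GL (Fin 2) F).val =
      ![0, e * ϖ ^ (-n)] := by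
    rw [upperGL_inv_val]
    ext i
    fin_cases i <;> simp [Matrix.vecMul, dotProduct, Fin.sum_univ_two]
  have hu : (upperGL (ϖ ^ m) (ϖ ^ n) y).val *ᵥ ![(0 : F), 1] = ![y, ϖ ^ n] := by
    rw [upperGL_val]
    ext i
    fin_cases i <;> simp [Matrix.mulVec, dotProduct, Fin.sum_univ_two]
  have hcz : ∀ (t : F) (k : ℤ), ‖algebraMap F E (ϖ : F) ^ r * (c * algebraMap F E
      (t * (ϖ : F) ^ k))‖ ≤ 1 ↔ ‖t‖ ≤ ‖(ϖ : F)‖ ^ (-(r + vc + k)) := by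
    intro t k
    rw [norm_mul, norm_mul, norm_pow, norm_algebraMap', norm_algebraMap', norm_mul, norm_zpow, hc,
      zpow_neg, ← one_div, le_div_iff₀ (hϖ.zpow_pos _), zpow_add₀ h0, zpow_add₀ h0, zpow_natCast]
    ring_nf
  have hint : ∀ t : E, ‖t‖ ≤ 1 → ‖algebraMap F E (ϖ : F) ^ r * t‖ ≤ 1 := by
    intro t ht
    rw [norm_mul, norm_pow, norm_algebraMap']
    exact mul_le_one₀ (pow_le_one₀ (norm_nonneg _) hϖ.2.1.le) (norm_nonneg _) ht
  have e00 : ‖algebraMap F E (ϖ : F) ^ r * (a + c * algebraMap F E (y * (ϖ : F) ^ (-m)))‖ ≤ 1 ↔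
      ‖y‖ ≤ ‖(ϖ : F)‖ ^ (m - r - vc) := by
    rw [show m - r - vc = -(r + vc + -m) by ring, ← hcz, mul_add]
    refine ⟨fun h => ?_, fun h => ultrametric_norm_add_le (hint a ha) h⟩
    simpa using ultrametric_norm_sub_le h (hint a ha)
  have e11 : ‖algebraMap F E (ϖ : F) ^ r * (d - c * algebraMap F E (y * (ϖ : F) ^ (-m)))‖ ≤ 1 ↔
      ‖y‖ ≤ ‖(ϖ : F)‖ ^ (m - r - vc) := by
    rw [show m - r - vc = -(r + vc + -m) by ring, ← hcz, mul_sub]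
    refine ⟨fun h => ?_, fun h => ultrametric_norm_sub_le (hint d hd) h⟩
    simpa using ultrametric_norm_sub_le (hint d hd) h
  have e01 : ‖algebraMap F E (ϖ : F) ^ r * (c * algebraMap F E
      ((B * ϖ ^ (2 * m) + A * ϖ ^ m * y - y ^ 2) * (ϖ : F) ^ (-m - n)))‖ ≤ 1 ↔
      ‖B * ϖ ^ (2 * m) + A * ϖ ^ m * y - y ^ 2‖ ≤ ‖(ϖ : F)‖ ^ (m - r - vc + n) := by
    rw [hcz]
    ring_nf
  have e10 : ‖algebraMap F E (ϖ : F) ^ r * (c * algebraMap F E ((ϖ : F) ^ (n - m)))‖ ≤ 1 ↔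
      m - r - vc ≤ n := by
    have := hcz 1 (n - m)
    rw [one_mul, norm_one, ← zpow_zero ‖(ϖ : F)‖, hϖ.zpow_le_zpow_iff] at this
    rw [← zpow_zero ‖(ϖ : F)‖, this]
    constructor <;> intro h <;> omega
  have en : ‖(ϖ : F) ^ n‖ ≤ 1 ↔ 0 ≤ n := by
    rw [norm_zpow, ← zpow_zero ‖(ϖ : F)‖, hϖ.zpow_le_zpow_iff]
  have ee : ‖e * (ϖ : F) ^ (-n)‖ ≤ 1 ↔ n ≤ ve := by
    rw [norm_mul, norm_zpow, he, ← zpow_add₀ h0, ← zpow_zero ‖(ϖ : F)‖, hϖ.zpow_le_zpow_iff]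
    constructor <;> intro h <;> omega
  simp only [OrbSupport]
  rw [hM, hv, hu]
  simp only [Fin.forall_fin_two, Matrix.of_apply, Matrix.cons_val', Matrix.cons_val_zero,
    Matrix.cons_val_one, Matrix.cons_val_fin_one, e00, e01, e10, e11, en, ee, norm_zero,
    zero_le_one, and_true]
  constructor
  · rintro ⟨⟨⟨h1, h2⟩, h3, -⟩, h4, h5, h6⟩
    exact ⟨h5, h6, h3, h4, h1, h2⟩
  · rintro ⟨h5, h6, h3, h4, h1, h2⟩
    exact ⟨⟨⟨h1, h2⟩, h3, h1⟩, h4, h5, h6⟩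

end OrbSupport

/-- The value at `s` of `η(det h) |det h|_F ^ (-s)` for `v(det h) = k`. -/
noncomputable def orbWeight (q : ℕ) (k : ℤ) (s : ℂ) : ℂ :=
  (-1) ^ k * (((q : ℝ) ^ (-k) : ℝ) : ℂ) ^ (-s)

theorem orbWeight_ne_zero {q : ℕ} (hq : 0 < q) (k : ℤ) (s : ℂ) : orbWeight q k s ≠ 0 := by
  have h1 : (0 : ℝ) < (q : ℝ) ^ (-k) := zpow_pos (by exact_mod_cast hq) _
  refine mul_ne_zero (zpow_ne_zero _ (by norm_num)) ?_
  rw [Complex.cpow_ne_zero_iff]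
  exact Or.inl (by exact_mod_cast h1.ne')

theorem hasDerivAt_orbWeight {q : ℕ} (hq : 0 < q) (k : ℤ) :
    HasDerivAt (orbWeight q k) ((-1) ^ k * (k * Real.log q)) 0 := by
  have h1 : (0 : ℝ) < (q : ℝ) ^ (-k) := zpow_pos (by exact_mod_cast hq) _
  have h2 : ((((q : ℝ) ^ (-k) : ℝ)) : ℂ) ≠ 0 := by exact_mod_cast h1.ne'
  have h3 := ((hasDerivAt_id (0 : ℂ)).neg.const_cpow (Or.inl h2)).const_mul ((-1 : ℂ) ^ k)
  refine h3.congr_deriv ?_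
  rw [← Complex.ofReal_log h1.le, Real.log_zpow]
  simp

theorem val_mul_of_norm_eq_one {F : Type*} [NormedField F] {ϖ x y : F} (hx : ‖x‖ = 1) : val ϖ (x * y) = val ϖ y := by
  rw [val, val, norm_mul, hx, one_mul]

/-! ### The orbital integral and its derivative as finite sums -/

section MainComputation

variable (p : ℕ) [Fact p.Prime] {F : Type*} [NormedField F] [NormedAlgebra ℚ_[p] F]
  [FiniteDimensional ℚ_[p] F] {E : Type*} [NormedField E] [NormedAlgebra F E]
  [MeasurableSpace (GL (Fin 2) F)] [BorelSpace (GL (Fin 2) F)]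

/-- The orbital integral as a finite sum, in terms of the number `cnt n i` of classes in
`quadraticSet`. -/
theorem orb_eq_sum {σ : E ≃ₐ[F] E} {ϖ : F} (hϖ : IsUniformizer ϖ)
    (μ : Measure (GL (Fin 2) F)) [μ.IsHaarMeasure] (hμ : μ (integralGL F 2) = 1)
    {a b c d : E} {e A B : F} {vc ve : ℤ} (hS : !![a, b; c, d] ∈ symmSpace σ 2)
    (hc : ‖c‖ = ‖ϖ‖ ^ vc) (he : ‖e‖ = ‖ϖ‖ ^ ve)
    (ha : ‖a‖ ≤ 1) (hd : ‖d‖ ≤ 1) (hA : algebraMap F E A * c = d - a)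
    (hB : algebraMap F E B * c = b) (r : ℕ) {cnt : ℕ → ℕ → ℕ} {N₀ I : ℕ} (hN₀ : N₀ = (ve + 1).toNat)
    (hcnt : ∀ n i : ℕ, ∃ Y, IsTransversal ϖ n (quadraticSet ϖ (A * ϖ ^ ((n : ℤ) - i + r + vc))
      (B * ϖ ^ (2 * ((n : ℤ) - i + r + vc))) n ((n : ℤ) - i)) Y ∧ Y.card = cnt n i)
    (hI : ∀ n i, n < N₀ → I ≤ i → cnt n i = 0) (s : ℂ) :
    Integrable (orbIntegrand p ϖ (Set.indicator (symmSpaceLE σ ϖ 2 r) 1)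
      (!![a, b; c, d], ![0, 1], ![0, e]) s) μ ∧
    Orb p ϖ μ (Set.indicator (symmSpaceLE σ ϖ 2 r) 1) (!![a, b; c, d], ![0, 1], ![0, e]) s =
      ∑ n ∈ Finset.range N₀, ∑ i ∈ Finset.range I,
        (cnt n i : ℂ) * orbWeight (residueCard p F) (2 * n - i + r + vc) s := by
  classical
  have huF := isUltrametricDist_of_padic p F
  have : IsUltrametricDist E := by
    let _ : NormedAlgebra ℚ_[p] E := NormedAlgebra.restrictScalars ℚ_[p] F E
    exact isUltrametricDist_of_padic p E
  have : ProperSpace F := FiniteDimensional.proper ℚ_[p] F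
  have hq : 0 < residueCard p F := (exists_residue_transversal p F hϖ).1.pos
  obtain ⟨u, rfl⟩ : ∃ u : Fˣ, (u : F) = ϖ := ⟨Units.mk0 ϖ hϖ.1, rfl⟩
  set x : Matrix (Fin 2) (Fin 2) E × (Fin 2 → F) × (Fin 2 → F) :=
    (!![a, b; c, d], ![0, 1], ![0, e]) with hx
  set f := orbIntegrand p (u : F) (Set.indicator (symmSpaceLE σ (u : F) 2 r) 1) x s with hf
  have hfeq : ∀ h, f h = if OrbSupport (u : F) r x h then
      orbWeight (residueCard p F) (val (u : F) (h : Matrix (Fin 2) (Fin 2) F).det) s else 0 :=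
    fun h => orbIntegrand_indicator_eq p (u : F) r hS s h
  have hdet : ∀ (m n : ℤ) (y : F),
      val (u : F) (upperGL (u ^ m) (u ^ n) y : Matrix (Fin 2) (Fin 2) F).det = m + n := by
    intro m n y
    refine val_eq hϖ ?_
    rw [upperGL_val, Matrix.det_fin_two_of, mul_zero, sub_zero, Units.val_zpow_eq_zpow_val,
      Units.val_zpow_eq_zpow_val, ← zpow_add₀ u.ne_zero, norm_zpow]
  have hsupp := orbSupport_upperGL_iff hϖ hc he ha hd hA hB r
  have hne : ∀ (m n : ℤ) (y : F), f (upperGL (u ^ m) (u ^ n) y) ≠ 0 ↔ 0 ≤ n ∧ n ≤ ve ∧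
      m - r - vc ≤ n ∧ y ∈ quadraticSet (u : F) (A * u ^ m) (B * u ^ (2 * m)) n (m - r - vc) := by
    intro m n y
    rw [← hsupp, hfeq, ite_ne_right_iff, and_iff_left (orbWeight_ne_zero hq _ _)]
  choose Y hY hYcard using hcnt
  -- Representatives are indexed by `(n, i)` with `m = n - i + r + v(c)`, so that `l = m - r - v(c)
  -- = n - i` and the support condition `l ≤ n` becomes `i ≥ 0`.
  have hmain := integral_GL_two_eq_sum hϖ μ hμ (f := f) ?_ (Finset.range N₀ ×ˢ Finset.range I)
    (fun j => (j.1 : ℤ) - j.2 + r + vc) (fun j => (j.1 : ℤ)) ?_ (fun j => Y j.1 j.2) ?_ ?_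
  · refine ⟨hmain.1, hmain.2.trans ?_⟩
    rw [Finset.sum_product]
    refine Finset.sum_congr rfl fun n hn => Finset.sum_congr rfl fun i hi => ?_
    rw [Finset.mem_range] at hn
    rw [← hYcard, ← nsmul_eq_mul, ← Finset.sum_const]
    refine Finset.sum_congr rfl fun y hy => ?_
    rw [hfeq, if_pos, hdet]
    · congr 1
      ring
    · rw [hsupp]
      refine ⟨by omega, by omega, by omega, ?_⟩
      have := (hY n i).subset y hy
      rwa [show (n : ℤ) - i + r + vc - r - vc = n - i by ring]
  · intro k hk h
    rw [hfeq, hfeq]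
    refine if_congr (orbSupport_mul_iff hk h) ?_ rfl
    rw [Units.val_mul, Matrix.det_mul, val_mul_of_norm_eq_one (norm_det_eq_one hk)]
  · rintro ⟨n, i⟩ - ⟨n', i'⟩ - h1 h2
    simp only at h1 h2
    rw [Prod.mk.injEq]
    omega
  · rintro ⟨n, i⟩ hj
    obtain ⟨hn, -⟩ := Finset.mem_product.mp hj
    rw [Finset.mem_range] at hn
    simp only at hn ⊢
    have hset : {y | f (upperGL (u ^ ((n : ℤ) - i + r + vc)) (u ^ (n : ℤ)) y) ≠ 0} =
        quadraticSet (u : F) (A * u ^ ((n : ℤ) - i + r + vc))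
          (B * u ^ (2 * ((n : ℤ) - i + r + vc))) n ((n : ℤ) - i) := by
      ext y
      refine (hne _ _ _).trans ?_
      rw [show (n : ℤ) - i + r + vc - r - vc = n - i by ring]
      exact ⟨fun h => h.2.2.2, fun h => ⟨by omega, by omega, by omega, h⟩⟩
    rw [hset]
    exact hY n i
  · intro k l y hy
    obtain ⟨h1, h2, h3, h4⟩ := (hne _ _ _).mp hy
    obtain ⟨n, rfl⟩ := Int.eq_ofNat_of_zero_le h1
    obtain ⟨i, hi⟩ := Int.eq_ofNat_of_zero_le (sub_nonneg.mpr h3)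
    obtain rfl : k = (n : ℤ) - i + r + vc := by
      have : ((i : ℕ) : ℤ) = n - (k - r - vc) := hi.symm
      omega
    have hn : n < N₀ := by omega
    refine ⟨(n, i), Finset.mem_product.mpr ⟨Finset.mem_range.mpr hn, Finset.mem_range.mpr ?_⟩,
      rfl, rfl⟩
    by_contra! hIi
    have h5 := hI n i hn hIi
    rw [← hYcard, Finset.card_eq_zero] at h5
    rw [show (n : ℤ) - i + r + vc - r - vc = n - i by ring] at h4
    obtain ⟨y', hy', -⟩ := (hY n i).exists_norm_le y h4
    simp [h5] at hy'

/-- Integrability, differentiability and the derivative at `0` of the orbital integral. -/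
theorem dOrb_eq_sum {σ : E ≃ₐ[F] E} {ϖ : F} (hϖ : IsUniformizer ϖ)
    (μ : Measure (GL (Fin 2) F)) [μ.IsHaarMeasure] (hμ : μ (integralGL F 2) = 1)
    {a b c d : E} {e A B : F} {vc ve : ℤ} (hS : !![a, b; c, d] ∈ symmSpace σ 2)
    (hc : ‖c‖ = ‖ϖ‖ ^ vc) (he : ‖e‖ = ‖ϖ‖ ^ ve)
    (ha : ‖a‖ ≤ 1) (hd : ‖d‖ ≤ 1) (hA : algebraMap F E A * c = d - a)
    (hB : algebraMap F E B * c = b) (r : ℕ) {cnt : ℕ → ℕ → ℕ} {N₀ I : ℕ} (hN₀ : N₀ = (ve + 1).toNat)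
    (hcnt : ∀ n i : ℕ, ∃ Y, IsTransversal ϖ n (quadraticSet ϖ (A * ϖ ^ ((n : ℤ) - i + r + vc))
      (B * ϖ ^ (2 * ((n : ℤ) - i + r + vc))) n ((n : ℤ) - i)) Y ∧ Y.card = cnt n i)
    (hI : ∀ n i, n < N₀ → I ≤ i → cnt n i = 0)
    {φ : Matrix (Fin 2) (Fin 2) E → ℂ} (hφ : φ = Set.indicator (symmSpaceLE σ ϖ 2 r) 1)
    {x : Matrix (Fin 2) (Fin 2) E × (Fin 2 → F) × (Fin 2 → F)}
    (hx : x = (!![a, b; c, d], ![0, 1], ![0, e])) :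
    (∀ s : ℂ, Integrable (orbIntegrand p ϖ φ x s) μ) ∧
    DifferentiableAt ℂ (fun s : ℂ => Orb p ϖ μ φ x s) 0 ∧
    (-1 : ℂ) ^ (vc + r) / (Real.log (residueCard p F) : ℂ) * dOrb p ϖ μ φ x =
      ∑ n ∈ Finset.range N₀, ∑ i ∈ Finset.range I,
        (-1) ^ i * (2 * n + (r + vc) - i) * (cnt n i : ℂ) := by
  subst hφ hx
  have h := orb_eq_sum p hϖ μ hμ hS hc he ha hd hA hB r hN₀ hcnt hI
  have hq1 : 1 < residueCard p F := (exists_residue_transversal p F hϖ).1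
  have hderiv : HasDerivAt (fun s : ℂ => Orb p ϖ μ (Set.indicator (symmSpaceLE σ ϖ 2 r) 1)
      (!![a, b; c, d], ![0, 1], ![0, e]) s)
      (∑ n ∈ Finset.range N₀, ∑ i ∈ Finset.range I, (cnt n i : ℂ) *
        ((-1) ^ (2 * (n : ℤ) - i + r + vc) * (((2 * n - i + r + vc : ℤ) : ℂ) *
          Real.log (residueCard p F)))) 0 := by
    simp only [fun s => (h s).2]
    exact HasDerivAt.fun_sum fun n _ => HasDerivAt.fun_sum fun i _ =>
      (hasDerivAt_orbWeight (by omega) _).const_mul _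
  refine ⟨fun s => (h s).1, hderiv.differentiableAt, ?_⟩
  rw [dOrb, hderiv.deriv, Finset.mul_sum]
  refine Finset.sum_congr rfl fun n _ => ?_
  rw [Finset.mul_sum]
  refine Finset.sum_congr rfl fun i _ => ?_
  have hlog : ((Real.log (residueCard p F) : ℝ) : ℂ) ≠ 0 := by
    exact_mod_cast (Real.log_pos (by exact_mod_cast hq1)).ne'
  -- The valuation of the determinant is congruent to `i + r + v(c)` modulo `2`, so the normalizing
  -- sign leaves `(-1)^i`.
  have hsgn : (-1 : ℂ) ^ (vc + r) * (-1) ^ (2 * (n : ℤ) - i + r + vc) = (-1) ^ i := by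
    rw [← zpow_add₀ (by norm_num), show vc + r + (2 * (n : ℤ) - i + r + vc) =
      2 * (n + r + vc - i) + i by ring, zpow_add₀ (by norm_num), zpow_mul]
    simp
  rw [← hsgn]
  field_simp
  push_cast
  ring

end MainComputation

/-! ### Comparison with the closed formula -/

theorem mainSum_eq_of_eq {q : ℕ} {ve vb vc : ℤ} {r M ε N : ℕ} (hM : vb + vc + 2 * r = 2 * M + 1)
    (hε : ve = ε) : mainSum q ve vb vc r N =
      ∑ j ∈ Finset.range (N + 1), ((ε : ℂ) + M + 1 - 2 * j) * (q : ℂ) ^ j := by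
  rw [mainSum_natCast]
  refine Finset.sum_congr rfl fun j _ => ?_
  have h : (vb : ℂ) + vc + 2 * r = 2 * M + 1 := by exact_mod_cast hM
  rw [hε]
  congr 1
  push_cast
  linear_combination h / 2

theorem cutoff_top (ve vb vc : ℤ) (r : ℕ) :
    cutoff ve vb vc ⊤ r = min ve ((vb + vc - 1) / 2 + r) := by
  rw [cutoff, WithTop.top_add, min_eq_left le_top, WithTop.untopD_coe]

theorem cutoff_coe (ve vb vc δ : ℤ) (r : ℕ) :
    cutoff ve vb vc (δ : WithTop ℤ) r = min (min ve ((vb + vc - 1) / 2 + r)) (δ + r) := by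
  rw [cutoff, ← WithTop.coe_add, ← WithTop.coe_min, WithTop.untopD_coe]

theorem valTop_eq_coe_iff {F K : Type*} [NormedField F] [NormedField K] {ϖ : F} {x : K} {δ : ℤ} :
    valTop ϖ x = δ ↔ x ≠ 0 ∧ val ϖ x = δ := by
  rw [valTop]
  split_ifs with h
  · simp [h]
  · simp [h]

theorem splitCount_eq_zero {q D G n i : ℕ} (h1 : 2 * D < i) (h2 : n + D < i)
    (h3 : G + max n D < i) : splitCount q D G n i = 0 := by
  rw [splitCount, if_neg (by omega), if_neg (by omega), if_neg (by omega)]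

/-- The derivative of the orbital integral when the linear term dominates, in closed form. -/
theorem sum_sum_splitCount_eq_mainSum {q D G M k r : ℕ} {ve vb vc δ : ℤ} (κ : ℂ)
    (hM : D + G = 2 * M + 1) (hDG : D < G) (hbc : vb + vc + 2 * r = 2 * M + 1)
    (hδ : δ + r = D) (he : ve = (D + k : ℕ)) :
    ∑ n ∈ Finset.range (D + k + 1), ∑ i ∈ Finset.range (2 * (M + 1) + (D + k)),
      (-1) ^ i * (2 * n + κ - i) * (splitCount q D G n i : ℂ) =
      mainSum q ve vb vc r D - (q : ℂ) ^ (δ + r) * correction ve vb vc δ r := by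
  rw [sum_sum_splitCount κ hM hDG, mainSum_eq_of_eq hbc he, Finset.sum_range_succ, hδ,
    zpow_natCast, correction, hδ, he, show ((D + k : ℕ) : ℤ) - D = k by push_cast; ring]
  have hM' : (D : ℂ) + G = 2 * M + 1 := by exact_mod_cast hM
  have hbc' : (vb : ℂ) + vc + 2 * r = 2 * M + 1 := by exact_mod_cast hbc
  have hδ' : (δ : ℂ) + r = D := by exact_mod_cast hδ
  split_ifs with hk <;> rw [Int.even_coe_nat] at hk
  · rw [hk.neg_one_pow]
    push_cast
    linear_combination ((q : ℂ) ^ D) * hM' / 2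
  · rw [(Nat.not_even_iff_odd.mp hk).neg_one_pow]
    push_cast
    linear_combination ((q : ℂ) ^ D) * (hbc' / 2 - 2 * hδ')

theorem mainTheorem3 (p : ℕ) [Fact p.Prime] (hp : p ≠ 2)
    (F : Type*) [NormedField F] [NormedAlgebra ℚ_[p] F] [FiniteDimensional ℚ_[p] F]
    (E : Type*) [NormedField E] [NormedAlgebra F E] (hE : IsUnramifiedQuadratic F E)
    (σ : E ≃ₐ[F] E) (hσ : σ ≠ 1) (ϖ : F) (hϖ : IsUniformizer ϖ)
    [MeasurableSpace (GL (Fin 2) F)] [BorelSpace (GL (Fin 2) F)]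
    (μ : Measure (GL (Fin 2) F)) [μ.IsHaarMeasure] (hμ : μ (integralGL F 2) = 1)
    (a b c d : E) (e : F)
    (x : Matrix (Fin 2) (Fin 2) E × (Fin 2 → F) × (Fin 2 → F))
    (hx : x = (!![a, b; c, d], ![0, 1], ![0, e])) (hrs : x ∈ rsMinus σ ϖ) (r : ℕ)
    (φ : Matrix (Fin 2) (Fin 2) E → ℂ) (hφ : φ = Set.indicator (symmSpaceLE σ ϖ 2 r) 1)
    (q : ℕ) (hq : q = residueCard p F)
    (N : ℤ) (hN : N = cutoff (val ϖ e) (val ϖ b) (val ϖ c) (valTop ϖ (d - a)) r) :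
    (∀ s : ℂ, Integrable (orbIntegrand p ϖ φ x s) μ) ∧
    DifferentiableAt ℂ (fun s : ℂ => Orb p ϖ μ φ x s) 0 ∧
    (∀ δ : ℤ, valTop ϖ (d - a) = δ → 0 ≤ val ϖ e - (δ + r) → 2 * δ < val ϖ b + val ϖ c →
      (-1 : ℂ) ^ (val ϖ c + r) / (Real.log q : ℂ) * dOrb p ϖ μ φ x =
        mainSum q (val ϖ e) (val ϖ b) (val ϖ c) r N -
          (q : ℂ) ^ (δ + r) * correction (val ϖ e) (val ϖ b) (val ϖ c) δ r) ∧
    ((¬ ∃ δ : ℤ, valTop ϖ (d - a) = δ ∧ 0 ≤ val ϖ e - (δ + r) ∧ 2 * δ < val ϖ b + val ϖ c) →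
      (-1 : ℂ) ^ (val ϖ c + r) / (Real.log q : ℂ) * dOrb p ϖ μ φ x =
        mainSum q (val ϖ e) (val ϖ b) (val ϖ c) r N) := by
  have huF := isUltrametricDist_of_padic p F
  have huE : IsUltrametricDist E := by
    let _ : NormedAlgebra ℚ_[p] E := NormedAlgebra.restrictScalars ℚ_[p] F E
    exact isUltrametricDist_of_padic p E
  have : CompleteSpace F := FiniteDimensional.complete ℚ_[p] F
  have hϖE := hE.isUniformizer_map ϖ hϖ
  have h0 := hϖ.norm_pos.ne'
  rw [hx] at hrs
  obtain ⟨hb, hc, he, ha, hd, hodd, hpos, A, B, hA, hB⟩ := rsMinus_structure hE hσ hϖ hrs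
  have hbn := norm_eq_zpow_val hϖ hϖE hb
  have hcn := norm_eq_zpow_val hϖ hϖE hc
  have hen := hϖ.norm_eq_zpow_val he
  have hdn : d - a ≠ 0 → ‖d - a‖ = ‖ϖ‖ ^ val ϖ (d - a) := norm_eq_zpow_val hϖ hϖE
  set vb := val ϖ b
  set vc := val ϖ c
  set ve := val ϖ e
  set δ₀ := val ϖ (d - a) with hδ₀
  -- `M = (v(b) + v(c) - 1)/2 + r` is the second entry in the minimum defining `N`; it is an integer
  -- by oddness.
  obtain ⟨M, hM⟩ : ∃ M : ℕ, vb + vc + 2 * r = 2 * M + 1 := by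
    obtain ⟨t, ht⟩ := hodd
    exact ⟨(t + r).toNat, by omega⟩
  have hscale : ∀ {x : E} {X : F} {k : ℤ}, algebraMap F E X * c = x → ‖x‖ = ‖ϖ‖ ^ k →
      ‖X‖ = ‖ϖ‖ ^ (k - vc) := by
    intro x X k hX hk
    rw [← hX, norm_mul, norm_algebraMap', hcn] at hk
    rw [zpow_sub₀ h0, ← hk, mul_div_cancel_right₀ _ (hϖ.zpow_pos vc).ne']
  have hBn := hscale hB hbn
  have hBm : ∀ l : ℤ, ‖B * ϖ ^ (2 * (l + r + vc))‖ = ‖ϖ‖ ^ (2 * M + 1 + 2 * l) := by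
    intro l
    rw [norm_mul, hBn, norm_zpow, ← zpow_add₀ h0]
    congr 1
    omega
  have key := fun (cnt : ℕ → ℕ → ℕ) (I : ℕ) =>
    dOrb_eq_sum p hϖ μ hμ hrs.1 hcn hen ha hd hA hB r (cnt := cnt) (I := I) rfl
      (hφ := hφ) (hx := hx)
  rw [← hq] at key
  -- This is the condition `2v(A) < v(B)`, under which the polynomial splits with roots of distinct
  -- valuations.
  by_cases hsplit : d - a ≠ 0 ∧ 2 * δ₀ < vb + vc
  · obtain ⟨hda, hδlt⟩ := hsplit
    replace hdn := hdn hda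
    have hδnn : 0 ≤ δ₀ := by
      have h1 := ultrametric_norm_sub_le hd ha
      rwa [hdn, ← zpow_zero ‖ϖ‖, hϖ.zpow_le_zpow_iff] at h1
    have hAn := hscale hA hdn
    have hAB : ‖B‖ < ‖A‖ ^ 2 := by
      rw [hAn, hBn, ← zpow_natCast, ← zpow_mul, hϖ.zpow_lt_zpow_iff]
      push_cast
      omega
    obtain ⟨s₁, s₂, hsum, hprod, hs₁, hs₂⟩ := exists_roots_of_norm_lt hAB
    -- `D` and `G` are the valuations of the two roots after scaling by `ϖ^(r + v(c))`; their sum is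
    -- the valuation `2M + 1` of the scaled constant term.
    obtain ⟨D, hD⟩ : ∃ D : ℕ, δ₀ + r = D := ⟨(δ₀ + r).toNat, by omega⟩
    obtain ⟨G, hG⟩ : ∃ G : ℕ, D + G = 2 * M + 1 := ⟨2 * M + 1 - D, by omega⟩
    have hDG : D < G := by omega
    have hs₁n : ∀ l : ℤ, ‖s₁ * ϖ ^ (l + r + vc)‖ = ‖ϖ‖ ^ (D + l) := by
      intro l
      rw [norm_mul, hs₁, hAn, norm_zpow, ← zpow_add₀ h0]
      congr 1
      omega
    have hs₂n : ∀ l : ℤ, ‖s₂ * ϖ ^ (l + r + vc)‖ = ‖ϖ‖ ^ (G + l) := by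
      intro l
      have h1 : ‖s₂‖ = ‖ϖ‖ ^ (vb - δ₀) := by
        rw [hAn, hBn, ← eq_div_iff (hϖ.zpow_pos _).ne', ← zpow_sub₀ h0] at hs₂
        rw [hs₂]
        congr 1
        omega
      rw [norm_mul, h1, norm_zpow, ← zpow_add₀ h0]
      congr 1
      omega
    -- The range of `i` must reach past `G + max(n, D)` for every `n ≤ v(e)`; the chosen length
    -- suffices because `D + G = 2M + 1`.
    obtain ⟨k1, k2, k3⟩ := key (splitCount q D G) (2 * (M + 1) + ve.toNat) (by
      intro n i
      have h1 := exists_isTransversal_split p hϖ (n := n) (i := i) rfl hDG (hs₁n (n - i))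
        (hs₂n (n - i))
      rw [← add_mul, hsum, ← hq] at h1
      have h2 : B * ϖ ^ (2 * ((n : ℤ) - i + r + vc)) = -(s₁ * ϖ ^ ((n : ℤ) - i + r + vc) *
          (s₂ * ϖ ^ ((n : ℤ) - i + r + vc))) := by
        rw [mul_comm 2, zpow_mul, zpow_ofNat]
        linear_combination (ϖ ^ ((n : ℤ) - i + r + vc)) ^ 2 * hprod
      rwa [← h2] at h1) (by
      intro n i hn hi
      exact splitCount_eq_zero (by omega) (by omega) (by omega))
    have hval : valTop ϖ (d - a) = δ₀ := valTop_eq_coe_iff.mpr ⟨hda, rfl⟩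
    rw [hval, cutoff_coe] at hN
    refine ⟨k1, k2, ?_, ?_⟩
    · rintro δ hδ hϰ -
      obtain rfl : δ₀ = δ := (valTop_eq_coe_iff.mp hδ).2
      obtain ⟨k, hk⟩ : ∃ k : ℕ, ve = (D + k : ℕ) := ⟨(ve - D).toNat, by omega⟩
      rw [k3, show (ve + 1).toNat = D + k + 1 by omega, show ve.toNat = D + k by omega,
        sum_sum_splitCount_eq_mainSum _ hG hDG hM hD hk]
      -- `D < G` gives `D ≤ M`, and `D ≤ v(e)` here, so the minimum is `D`.
      rw [show N = (D : ℤ) by omega]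
    · intro hno
      -- Since the polynomial splits, failure of the case condition means `v(e) < D`. All `n ≤ v(e)`
      -- are then below `D`, where the counts agree with the non-split ones.
      have hlt : ve < D := by
        by_contra! hle
        exact hno ⟨δ₀, hval, by omega, hδlt⟩
      rw [k3]
      rcases lt_or_ge ve 0 with hneg | hnn
      · rw [show (ve + 1).toNat = 0 by omega, Finset.sum_range_zero, mainSum_of_neg (by omega)]
      · obtain ⟨ε, hε⟩ := Int.eq_ofNat_of_zero_le hnn
        rw [show N = (ε : ℤ) by omega, mainSum_eq_of_eq hM hε, hε,
          show ((ε : ℤ) + 1).toNat = ε + 1 by omega, Int.toNat_natCast]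
        have h1 := sum_sum_nonsplitCount (r + vc) q M ε
        rw [min_eq_left (by omega)] at h1
        rw [← h1]
        refine Finset.sum_congr rfl fun n hn => Finset.sum_congr rfl fun i _ => ?_
        rw [splitCount_eq_nonsplitCount hG hDG (by have := Finset.mem_range.mp hn; omega)]
  -- Oddness of `v(b) + v(c)` turns the failed inequality into a strict one in the other direction,
  -- so `v(d-a)` never attains the minimum in `N`.
  · have hδ : ∀ δ : ℤ, valTop ϖ (d - a) = δ → M + 1 ≤ δ + r := by
      intro δ hδ
      obtain ⟨h1, h2⟩ := valTop_eq_coe_iff.mp hδ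
      by_contra! hlt
      exact hsplit ⟨h1, by omega⟩
    have hAm : ∀ l : ℤ, ‖A * ϖ ^ (l + r + vc)‖ ≤ ‖ϖ‖ ^ (M + 1 + l) := by
      intro l
      by_cases hda : d - a = 0
      · rw [hda, mul_eq_zero, map_eq_zero, or_iff_left hc] at hA
        rw [hA, zero_mul, norm_zero]
        exact (hϖ.zpow_pos _).le
      · have h1 := hδ δ₀ (valTop_eq_coe_iff.mpr ⟨hda, rfl⟩)
        rw [norm_mul, hscale hA (hdn hda), norm_zpow, ← zpow_add₀ h0, hϖ.zpow_le_zpow_iff]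
        omega
    have hNM : N = min ve M := by
      rw [hN]
      by_cases hda : d - a = 0
      · rw [valTop, if_pos hda, cutoff_top]
        omega
      · have h1 := hδ δ₀ (valTop_eq_coe_iff.mpr ⟨hda, rfl⟩)
        rw [valTop_eq_coe_iff.mpr ⟨hda, rfl⟩, cutoff_coe]
        omega
    obtain ⟨k1, k2, k3⟩ := key (nonsplitCount q M) (2 * (M + 1) + ve.toNat) (by
      intro n i
      have h1 := exists_isTransversal_nonsplit p hϖ (n := n) (i := i) rfl (hBm (n - i))
        (hAm (n - i))
      rwa [← hq] at h1) (by
      intro n i hn hi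
      rw [nonsplitCount, if_neg (by omega)])
    refine ⟨k1, k2, ?_, ?_⟩
    · intro δ h1 _ h3
      have := hδ δ h1
      omega
    · intro _
      rw [k3]
      rcases lt_or_ge ve 0 with hneg | hnn
      · rw [show (ve + 1).toNat = 0 by omega, Finset.sum_range_zero, mainSum_of_neg (by omega)]
      · obtain ⟨ε, hε⟩ := Int.eq_ofNat_of_zero_le hnn
        rw [show N = (min ε M : ℕ) by omega, mainSum_eq_of_eq hM hε, hε,
          show ((ε : ℤ) + 1).toNat = ε + 1 by omega, Int.toNat_natCast]
        exact sum_sum_nonsplitCount (r + vc) q M ε
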